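/- Let $n\ge 1$, $R>0$, $\gamma>1$, $\mu>0$, $2\mu+n\lambda>0$, $\mathcal K\ge 0$, let $m$ be an integer with $m>[n/2]+2$, and put $c_\nu=R/(\gamma-1)$. Consider the Cauchy problem in $\mathbb R^n$ for the full compressible Navier–Stokes equations $$\partial_t\rho+\operatorname{div}(\rho u)=0,$$ $$\partial_t(\rho u)+\operatorname{div}(\rho u\otimes u)+\nabla p=\operatorname{div}\mathcal T,$$ $$\partial_t\big(\tfrac12\rho|u|^2+\rho e\big)+\operatorname{div}\big((\tfrac12\rho|u|^2+\rho e+p)u\big)=\operatorname{div}(u\mathcal T)+\mathcal K\Delta\theta,$$ with stress tensor $\mathcal T=\mu(\nabla u+(\nabla u)^t)+\lambda(\operatorname{div}u)I$ and state equations $p=R\rho\theta=\exp(s/c_\nu)\rho^\gamma$, $e=c_\nu\theta$, where $\rho\ge 0$ is the density, $u$ the velocity, $s$ the entropy and $\theta$ the temperature. Let the initial data $(\rho,u,s)|_{t=0}=(\rho_0,u_0,s_0)$ be such that $\rho_0$ has compact support and positive mass, $\int_{\mathbb R^n}\rho_0\,dx>0$. Then every smooth solution blows up in finite time: there is $T^*>0$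 (fixed once the parameters and the initial data are fixed) such that $T<T^*$ whenever there is, on $[0,T]$ with $T>0$, a classical solution $(\rho,u,s)\in C^1([0,T];H^m(\mathbb R^n))$, with temperature $\theta$, of this Cauchy problem which, if $\mathcal K\neq 0$, satisfies $$|\nabla\theta(x,t)|=o\big(|x|^{-(n-1)}\big)\quad\text{as }|x|\to\infty,\ \text{for every }t\in(0,T].$$ Here a classical solution is one for which $\rho,u,s$ are $C^1$ on $[0,T]\times\mathbb R^n$, $u(\cdot,t)$ is $C^2$ for every $t\in[0,T]$, and, if $\mathcal K\ne0$, $\theta(\cdot,t)$ is $C^2$ for every $t\in(0,T]$. -/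

import Mathlib

open MeasureTheory Set Filter Topology Asymptotics
open scoped SchwartzMap InnerProductSpace

noncomputable section

namespace CNS

/-- The space `ℝⁿ` with its Euclidean norm. -/
abbrev Space (n : ℕ) : Type := EuclideanSpace ℝ (Fin n)

/-- The partial derivative `∂ⱼ f (x)`. -/
def pderiv {n : ℕ} (j : Fin n) (f : Space n → ℝ) (x : Space n) : ℝ :=
  fderiv ℝ f x (EuclideanSpace.single j 1)

/-- The divergence `div v (x) = ∑ⱼ ∂ⱼ vⱼ (x)`. -/
def divergence {n : ℕ} (v : Space n → Space n) (x : Space n) : ℝ :=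
  ∑ j, pderiv j (fun y => v y j) x

/-- The entry `𝒯ᵢⱼ = μ (∂ⱼ uᵢ + ∂ᵢ uⱼ) + λ (div u) δᵢⱼ` of the stress tensor of the velocity
field `v`. -/
def stress {n : ℕ} (μ lam : ℝ) (v : Space n → Space n) (i j : Fin n) (x : Space n) : ℝ :=
  μ * (pderiv j (fun y => v y i) x + pderiv i (fun y => v y j) x)
    + if i = j then lam * divergence v x else 0

/-- The specific heat at constant volume, `c_ν = R / (γ - 1)`. -/
def specificHeat (R γ : ℝ) : ℝ := R / (γ - 1)

/-- The pressure `p = R ρ θ`. -/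
def pressure {n : ℕ} (R : ℝ) (ρ θ : ℝ → Space n → ℝ) (t : ℝ) (x : Space n) : ℝ :=
  R * ρ t x * θ t x

/-- The total energy density `½ ρ |u|² + ρ e`, where `e = c_ν θ` is the internal energy. -/
def energyDensity {n : ℕ} (R γ : ℝ) (ρ : ℝ → Space n → ℝ) (u : ℝ → Space n → Space n)
    (θ : ℝ → Space n → ℝ) (t : ℝ) (x : Space n) : ℝ :=
  1 / 2 * ρ t x * ‖u t x‖ ^ 2 + ρ t x * (specificHeat R γ * θ t x)

/-- `(ρ, u, s)`, with temperature `θ`, is a classical solution on `[0, T] × ℝⁿ` of the full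
compressible Navier-Stokes equations of a polytropic gas. In regions of vacuum the state equation
leaves `θ` free. When the heat conduction `K` vanishes, no regularity of `θ` itself is required:
only `ρ θ` enters the equations, and the state equation expresses it through `ρ` and `s`. -/
structure IsClassicalSolution {n : ℕ} (R γ μ lam K T : ℝ) (ρ : ℝ → Space n → ℝ)
    (u : ℝ → Space n → Space n) (s θ : ℝ → Space n → ℝ) : Prop where
  contDiff_density :
    ContDiffOn ℝ 1 (fun q : ℝ × Space n => ρ q.1 q.2) (Icc 0 T ×ˢ univ)
  contDiff_velocity :
    ContDiffOn ℝ 1 (fun q : ℝ × Space n => u q.1 q.2) (Icc 0 T ×ˢ univ)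
  contDiff_entropy :
    ContDiffOn ℝ 1 (fun q : ℝ × Space n => s q.1 q.2) (Icc 0 T ×ˢ univ)
  contDiff_two_velocity : ∀ t ∈ Icc 0 T, ContDiff ℝ 2 (u t)
  contDiff_two_temperature : K ≠ 0 → ∀ t ∈ Ioc 0 T, ContDiff ℝ 2 (θ t)
  density_nonneg : ∀ t ∈ Icc 0 T, ∀ x, 0 ≤ ρ t x
  /-- The state equation `R ρ θ = p = exp (s / c_ν) ρ ^ γ`. -/
  state : ∀ t ∈ Icc 0 T, ∀ x,
    pressure R ρ θ t x = Real.exp (s t x / specificHeat R γ) * ρ t x ^ γ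
  /-- `∂ₜ ρ + div (ρ u) = 0`. -/
  mass : ∀ t ∈ Ioo 0 T, ∀ x,
    deriv (fun τ => ρ τ x) t + divergence (fun y => ρ t y • u t y) x = 0
  /-- `∂ₜ (ρ u) + div (ρ u ⊗ u) + ∇ p = div 𝒯`, by components. -/
  momentum : ∀ t ∈ Ioo 0 T, ∀ x, ∀ i : Fin n,
    deriv (fun τ => ρ τ x * u τ x i) t
        + ∑ j, pderiv j (fun y => ρ t y * u t y i * u t y j) x
        + pderiv i (pressure R ρ θ t) x
      = ∑ j, pderiv j (stress μ lam (u t) i j) x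
  /-- `∂ₜ (½ ρ |u|² + ρ e) + div ((½ ρ |u|² + ρ e + p) u) = div (u 𝒯) + K Δ θ`. -/
  energy : ∀ t ∈ Ioo 0 T, ∀ x,
    deriv (fun τ => energyDensity R γ ρ u θ τ x) t
        + divergence (fun y => (energyDensity R γ ρ u θ t y + pressure R ρ θ t y) • u t y) x
      = ∑ j, pderiv j (fun y => ∑ i, u t y i * stress μ lam (u t) i j y) x
        + K * Laplacian.laplacian (θ t) x

/-- `f ∈ C¹([0, T]; Hᵐ(ℝⁿ))`. The Bessel potential operator of order `m` is an isomorphism from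
`Hᵐ` onto `L²`; here `v` is the curve `f` with values in `L²`, and `g` is its image under this
operator, which has to be a `C¹` curve in `L²`. -/
def IsC1Sobolev {n : ℕ} (m : ℕ) (T : ℝ) (f : ℝ → Space n → ℝ) : Prop :=
  ∃ v g : ℝ → Lp ℂ 2 (volume : Measure (Space n)),
    (∀ t ∈ Icc 0 T, v t =ᵐ[volume] fun x => (f t x : ℂ)) ∧
    (∀ t ∈ Icc 0 T, TemperedDistribution.besselPotential (Space n) ℂ (m : ℝ)
      (v t : 𝓢'(Space n, ℂ)) = (g t : 𝓢'(Space n, ℂ))) ∧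
    ContDiffOn ℝ 1 g (Icc 0 T)

/-- The temperature gradient satisfies `|∇θ| = o(1 / |x|^(n-1))` as `|x| → ∞`, for every
`t ∈ (0, T]`. -/
def TemperatureGradientDecay {n : ℕ} (T : ℝ) (θ : ℝ → Space n → ℝ) : Prop :=
  ∀ t ∈ Ioc 0 T,
    (fun x => gradient (θ t) x) =o[cocompact (Space n)] fun x => 1 / ‖x‖ ^ (n - 1)

end CNS

end

/-!
Off the support of the gas all terms of the energy equation vanish except the dissipation and the
heat conduction, so `K Δθ = -∇u : 𝒯 ≤ 0` there. In the gas, `θ` is a continuous function of `ρ` and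
`s` vanishing at the boundary, which makes the integral of `Δθ` over the gas nonpositive, while the
decay of `∇θ` makes the integral over the whole space vanish. Hence `Δθ = 0` and `∇u : 𝒯 = 0` in the
vacuum: the deformation tensor of `u` vanishes outside any ball containing the gas, where `u` is
therefore an infinitesimal rigid motion, and being in `Lᵖ` it is zero. So a particle leaving the
ball that contains the initial gas is slowed down by a fluid at rest, and the gas never leaves this
ball.

With the gas confined to a ball of radius `r`, the mass `M` and the energy `E` are conserved, and
the radial momentum `F = ∫ ρ ⟨x, u⟩` satisfies `F' = ∫ (ρ |u|² + n p) ≥ min 2 (n (γ - 1)) E` by the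
virial identity. Since `|F| ≤ r (M / 2 + E)`, this bounds the lifespan.
-/

noncomputable section

namespace CNS

section Sobolev

open FourierTransform TemperedDistribution

theorem integral_norm_mul_norm_le {α F G : Type*} [MeasurableSpace α] {μ : Measure α}
    [NormedAddCommGroup F] [NormedAddCommGroup G] {f : α → F} {g : α → G}
    (hf : MemLp f 2 μ) (hg : MemLp g 2 μ) :
    ∫ x, ‖f x‖ * ‖g x‖ ∂μ ≤ (eLpNorm f 2 μ).toReal * (eLpNorm g 2 μ).toReal := by
  calc ∫ x, ‖f x‖ * ‖g x‖ ∂μ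
      = ⟪hf.norm.toLp, hg.norm.toLp⟫_ℝ := by
        rw [L2.inner_def]
        refine integral_congr_ae ?_
        filter_upwards [hf.norm.coeFn_toLp, hg.norm.coeFn_toLp] with x hfx hgx
        simp [hfx, hgx, mul_comm]
    _ ≤ ‖hf.norm.toLp‖ * ‖hg.norm.toLp‖ := real_inner_le_norm _ _
    _ = _ := by rw [Lp.norm_toLp, Lp.norm_toLp, eLpNorm_norm, eLpNorm_norm]

theorem norm_integral_mul_mul_le {α : Type*} [MeasurableSpace α] {μ : Measure α} {b : α → ℝ}
    {ψ g : α → ℂ} (hb : MemLp b 2 μ) (hg : MemLp g 2 μ) {C : ℝ} (hC : 0 ≤ C)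
    (hψ : ∀ x, ‖ψ x‖ ≤ C) :
    ‖∫ x, (b x * ψ x) * g x ∂μ‖ ≤ (eLpNorm b 2 μ).toReal * (eLpNorm g 2 μ).toReal * C := by
  have hint : Integrable (fun x => ‖b x‖ * ‖g x‖) μ := hb.norm.integrable_mul hg.norm
  calc ‖∫ x, (b x * ψ x) * g x ∂μ‖
      ≤ ∫ x, ‖b x‖ * ‖g x‖ * C ∂μ := by
        refine norm_integral_le_of_norm_le (hint.mul_const C) (Eventually.of_forall fun x => ?_)
        rw [norm_mul, norm_mul, Complex.norm_real, mul_right_comm]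
        gcongr
        exact hψ x
    _ = (∫ x, ‖b x‖ * ‖g x‖ ∂μ) * C := integral_mul_const _ _
    _ ≤ _ := by
        gcongr
        exact integral_norm_mul_norm_le hb hg

variable {E : Type*} [NormedAddCommGroup E]

/-- The function `(1 + |ξ|²) ^ (-s / 2)`, the symbol of the Bessel potential of order `-s`. -/
def besselSymbol (s : ℝ) (ξ : E) : ℝ := (1 + ‖ξ‖ ^ 2) ^ (-s / 2)

variable [InnerProductSpace ℝ E]

theorem hasTemperateGrowth_besselSymbol (s : ℝ) :
    (fun ξ : E => (besselSymbol s ξ : ℂ)).HasTemperateGrowth := by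
  unfold besselSymbol
  fun_prop

variable [FiniteDimensional ℝ E] [MeasurableSpace E] [BorelSpace E]

theorem norm_fourierInv_apply_le (φ : 𝓢(E, ℂ)) (ξ : E) : ‖(𝓕⁻ φ) ξ‖ ≤ ∫ x, ‖φ x‖ := by
  rw [SchwartzMap.fourierInv_coe]
  exact VectorFourier.norm_fourierIntegral_le_integral_norm _ _ _ _ _

theorem memLp_besselSymbol {s : ℝ} (hs : Module.finrank ℝ E < 2 * s) :
    MemLp (besselSymbol s : E → ℝ) 2 := by
  have hcont : Continuous (besselSymbol s : E → ℝ) :=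
    (continuous_const.add (continuous_norm.pow 2)).rpow_const fun ξ =>
      Or.inl (by positivity : (1 : ℝ) + ‖ξ‖ ^ 2 ≠ 0)
  rw [memLp_two_iff_integrable_sq hcont.aestronglyMeasurable]
  refine (integrable_rpow_neg_one_add_norm_sq hs).congr (Eventually.of_forall fun ξ => ?_)
  simp only [besselSymbol]
  rw [← Real.rpow_mul_natCast (by positivity)]
  congr 1
  push_cast
  ring

theorem apply_eq_integral_besselSymbol {s : ℝ} {f : 𝓢'(E, ℂ)} {g : Lp ℂ 2 (volume : Measure E)}
    (h : besselPotential E ℂ s f = (g : 𝓢'(E, ℂ))) (φ : 𝓢(E, ℂ)) :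
    f φ = ∫ ξ, (besselSymbol s ξ * (𝓕⁻ φ) ξ) * (𝓕 g : Lp ℂ 2 (volume : Measure E)) ξ := by
  have hf : 𝓕 f = smulLeftCLM ℂ (fun ξ => (besselSymbol s ξ : ℂ))
      ((𝓕 g : Lp ℂ 2 (volume : Measure E)) : 𝓢'(E, ℂ)) := by
    rw [← (besselPotential_neg_apply_eq_iff s _ _).2 h,
      fourier_besselPotential_eq_smulLeftCLM_fourier_apply, Lp.fourier_toTemperedDistribution_eq]
    rfl
  calc f φ = 𝓕 f (𝓕⁻ φ) := by
        rw [TemperedDistribution.fourier_apply, fourier_fourierInv_eq]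
    _ = _ := by
        simp only [hf, smulLeftCLM_apply_apply, Lp.toTemperedDistribution_apply, smul_eq_mul,
          SchwartzMap.smulLeftCLM_apply_apply (hasTemperateGrowth_besselSymbol s)]

/-- Together with Plancherel's formula this is the Sobolev embedding `Hˢ ⊆ (L¹)'`, `s > n / 2`. -/
theorem norm_apply_le_of_besselPotential_eq {s : ℝ} (hs : Module.finrank ℝ E < 2 * s)
    {f : 𝓢'(E, ℂ)} {g : Lp ℂ 2 (volume : Measure E)}
    (h : besselPotential E ℂ s f = (g : 𝓢'(E, ℂ))) (φ : 𝓢(E, ℂ)) :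
    ‖f φ‖ ≤ (eLpNorm (besselSymbol s : E → ℝ) 2).toReal * ‖g‖ * ∫ x, ‖φ x‖ := by
  rw [apply_eq_integral_besselSymbol h, ← Lp.norm_fourier_eq g, Lp.norm_def]
  exact norm_integral_mul_mul_le (memLp_besselSymbol hs) (Lp.memLp _)
    (integral_nonneg fun _ => norm_nonneg _) (norm_fourierInv_apply_le φ)

theorem norm_le_of_norm_integral_le {f : E → ℂ} (hf : Continuous f) {A : ℝ}
    (h : ∀ φ : 𝓢(E, ℂ), ‖∫ x, φ x * f x‖ ≤ A * ∫ x, ‖φ x‖) (x : E) : ‖f x‖ ≤ A := by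
  let b (k : ℕ) : ContDiffBump (0 : E) := ⟨1 / (k + 1) / 2, 1 / (k + 1), by positivity,
    half_lt_self (by positivity)⟩
  refine le_of_tendsto' (ContDiffBump.convolution_tendsto_right_of_continuous (μ := volume)
    (φ := b) tendsto_one_div_add_atTop_nhds_zero_nat hf x).norm fun k => ?_
  have hsmooth : ContDiff ℝ (⊤ : ℕ∞) fun y => (((b k).normed volume (x - y) : ℝ) : ℂ) :=
    Complex.ofRealCLM.contDiff.comp ((b k).contDiff_normed.comp (by fun_prop))
  have hsupp : HasCompactSupport fun y => (((b k).normed volume (x - y) : ℝ) : ℂ) :=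
    ((b k).hasCompactSupport_normed.comp_homeomorph (Homeomorph.subLeft x)).comp_left
      (g := fun r : ℝ => (r : ℂ)) rfl
  have hA := h (hsupp.toSchwartzMap hsmooth)
  have hmass : ∫ y, ‖(((b k).normed volume (x - y) : ℝ) : ℂ)‖ = 1 := by
    simp only [Complex.norm_real, Real.norm_of_nonneg ((b k).nonneg_normed _)]
    rw [integral_sub_left_eq_self (fun y => (b k).normed volume y) volume x]
    exact (b k).integral_normed
  simp only [HasCompactSupport.toSchwartzMap_toFun, hmass, mul_one] at hA
  simpa [convolution_eq_swap, Complex.real_smul] using hA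

end Sobolev

section SobolevCurves

variable {n m : ℕ} {T : ℝ}

theorem IsC1Sobolev.exists_abs_le {f : ℝ → Space n → ℝ} (h : IsC1Sobolev m T f) (hm : n < 2 * m)
    (hf : ∀ t ∈ Icc 0 T, Continuous (f t)) : ∃ A : ℝ, ∀ t ∈ Icc 0 T, ∀ x, |f t x| ≤ A := by
  obtain ⟨v, g, hv, hvg, hg⟩ := h
  obtain ⟨B, hB⟩ := isCompact_Icc.exists_bound_of_continuousOn hg.continuousOn
  have hs : (Module.finrank ℝ (Space n) : ℝ) < 2 * (m : ℝ) := by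
    rw [finrank_euclideanSpace_fin]
    exact_mod_cast hm
  refine ⟨(eLpNorm (besselSymbol m : Space n → ℝ) 2).toReal * B, fun t ht x => ?_⟩
  rw [← Real.norm_eq_abs, ← Complex.norm_real]
  refine norm_le_of_norm_integral_le (Complex.continuous_ofReal.comp (hf t ht)) (fun φ => ?_) x
  calc ‖∫ y, φ y * (f t y : ℂ)‖ = ‖(v t : 𝓢'(Space n, ℂ)) φ‖ := by
        rw [Lp.toTemperedDistribution_apply]
        refine congrArg norm (integral_congr_ae ?_)
        filter_upwards [hv t ht] with y hy
        rw [hy, smul_eq_mul]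
    _ ≤ _ := norm_apply_le_of_besselPotential_eq hs (hvg t ht) φ
    _ ≤ _ := by
        gcongr
        exact hB t ht

theorem IsC1Sobolev.memLp {f : ℝ → Space n → ℝ} (h : IsC1Sobolev m T f) {t : ℝ}
    (ht : t ∈ Icc 0 T) : MemLp (f t) 2 := by
  obtain ⟨v, -, hv, -⟩ := h
  simpa using ((Lp.memLp (v t)).ae_eq (hv t ht)).re

theorem exists_norm_le_of_isC1Sobolev {u : ℝ → Space n → Space n}
    (h : ∀ i, IsC1Sobolev m T fun t x => u t x i) (hm : n < 2 * m)
    (hu : ∀ t ∈ Icc 0 T, Continuous (u t)) : ∃ U : ℝ, ∀ t ∈ Icc 0 T, ∀ x, ‖u t x‖ ≤ U := by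
  choose A hA using fun i => (h i).exists_abs_le hm fun t ht => by
    have := hu t ht
    fun_prop
  refine ⟨∑ i, A i, fun t ht x => ?_⟩
  calc ‖u t x‖ = ‖∑ i, u t x i • EuclideanSpace.basisFun (Fin n) ℝ i‖ := by
        exact congrArg norm ((EuclideanSpace.basisFun (Fin n) ℝ).sum_repr (u t x)).symm
    _ ≤ ∑ i, A i := norm_sum_le_of_le _ fun i _ => by simpa [norm_smul] using hA i t ht x

end SobolevCurves

section PartialDerivatives

variable {n : ℕ}

theorem fderiv_apply_eq_sum_pderiv (f : Space n → ℝ) (x v : Space n) :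
    fderiv ℝ f x v = ∑ j, v j * pderiv j f x := by
  conv_lhs => rw [← (EuclideanSpace.basisFun (Fin n) ℝ).sum_repr v]
  simp [pderiv]

theorem contDiff_coord {k : WithTop ℕ∞} {v : Space n → Space n} (hv : ContDiff ℝ k v) (i : Fin n) :
    ContDiff ℝ k (fun y => v y i) :=
  (EuclideanSpace.proj (𝕜 := ℝ) i).contDiff.comp hv

theorem differentiableAt_coord {v : Space n → Space n} {x : Space n}
    (hv : DifferentiableAt ℝ v x) (i : Fin n) : DifferentiableAt ℝ (fun y => v y i) x :=
  (EuclideanSpace.proj (𝕜 := ℝ) i).differentiableAt.comp x hv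

theorem pderiv_coord {v : Space n → Space n} {x : Space n} (hv : DifferentiableAt ℝ v x)
    (i j : Fin n) : pderiv j (fun y => v y i) x = fderiv ℝ v x (EuclideanSpace.single j 1) i := by
  have hcomp : HasFDerivAt (fun y => v y i) _ x :=
    (EuclideanSpace.proj (𝕜 := ℝ) i).hasFDerivAt.comp x hv.hasFDerivAt
  rw [pderiv, hcomp.fderiv]
  rfl

theorem pderiv_mul {f g : Space n → ℝ} {x : Space n} (hf : DifferentiableAt ℝ f x)
    (hg : DifferentiableAt ℝ g x) (j : Fin n) :
    pderiv j (fun y => f y * g y) x = f x * pderiv j g x + g x * pderiv j f x := by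
  simp [pderiv, fderiv_fun_mul hf hg]

theorem pderiv_add {f g : Space n → ℝ} {x : Space n} (hf : DifferentiableAt ℝ f x)
    (hg : DifferentiableAt ℝ g x) (j : Fin n) :
    pderiv j (fun y => f y + g y) x = pderiv j f x + pderiv j g x := by
  simp [pderiv, fderiv_fun_add hf hg]

theorem pderiv_sub {f g : Space n → ℝ} {x : Space n} (hf : DifferentiableAt ℝ f x)
    (hg : DifferentiableAt ℝ g x) (j : Fin n) :
    pderiv j (fun y => f y - g y) x = pderiv j f x - pderiv j g x := by
  simp [pderiv, fderiv_fun_sub hf hg]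

theorem pderiv_sum {ι : Type*} {s : Finset ι} {f : ι → Space n → ℝ} {x : Space n}
    (hf : ∀ i ∈ s, DifferentiableAt ℝ (f i) x) (j : Fin n) :
    pderiv j (fun y => ∑ i ∈ s, f i y) x = ∑ i ∈ s, pderiv j (f i) x := by
  simp [pderiv, fderiv_fun_sum hf]

theorem pderiv_eq_zero_of_eventuallyEq {f : Space n → ℝ} {x : Space n} (h : f =ᶠ[𝓝 x] 0)
    (j : Fin n) : pderiv j f x = 0 := by
  rw [pderiv, h.fderiv_eq]
  simp

theorem pderiv_eq_zero_of_nonneg {f : Space n → ℝ} (hf : ∀ y, 0 ≤ f y) {x : Space n}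
    (hx : f x = 0) (j : Fin n) : pderiv j f x = 0 := by
  have hmin : IsLocalMin f x := Eventually.of_forall fun y => hx.trans_le (hf y)
  simp [pderiv, hmin.fderiv_eq_zero]

theorem pderiv_coordinate (i j : Fin n) (x : Space n) :
    pderiv j (fun y : Space n => y i) x = if i = j then 1 else 0 := by
  rw [show (fun y : Space n => y i) = fun y => (id y) i from rfl, pderiv_coord differentiableAt_id]
  simp

theorem contDiff_pderiv {k l : WithTop ℕ∞} {f : Space n → ℝ} (hf : ContDiff ℝ k f)
    (h : l + 1 ≤ k) (j : Fin n) : ContDiff ℝ l (pderiv j f) :=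
  (hf.fderiv_right h).clm_apply contDiff_const

theorem continuous_pderiv {f : Space n → ℝ} (hf : ContDiff ℝ 1 f) (j : Fin n) :
    Continuous (pderiv j f) :=
  (contDiff_pderiv (l := 0) hf (by norm_num) j).continuous

theorem divergence_smul {f : Space n → ℝ} {v : Space n → Space n} {x : Space n}
    (hf : DifferentiableAt ℝ f x) (hv : DifferentiableAt ℝ v x) :
    divergence (fun y => f y • v y) x = f x * divergence v x + fderiv ℝ f x (v x) := by
  simp only [divergence, fderiv_apply_eq_sum_pderiv, Finset.mul_sum, ← Finset.sum_add_distrib]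
  exact Finset.sum_congr rfl fun j _ => pderiv_mul hf (differentiableAt_coord hv j) j

theorem abs_divergence_le {v : Space n → Space n} {x : Space n} (hv : DifferentiableAt ℝ v x) :
    |divergence v x| ≤ n * ‖fderiv ℝ v x‖ := by
  calc |divergence v x| ≤ ∑ j, |pderiv j (fun y => v y j) x| := Finset.abs_sum_le_sum_abs _ _
    _ ≤ ∑ _j : Fin n, ‖fderiv ℝ v x‖ := by
        refine Finset.sum_le_sum fun j _ => ?_
        rw [pderiv_coord hv, ← Real.norm_eq_abs]
        refine (PiLp.norm_apply_le _ j).trans ?_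
        simpa using (fderiv ℝ v x).le_opNorm (EuclideanSpace.single j 1)
    _ = n * ‖fderiv ℝ v x‖ := by simp

end PartialDerivatives

section Slab

variable {V E : Type*} [NormedAddCommGroup V] [NormedSpace ℝ V] [NormedAddCommGroup E]
  [NormedSpace ℝ E] {T : ℝ}

/-- `f` is jointly `C¹` in time and space on the slab `[0, T] × V`. -/
def IsC1OnSlab (T : ℝ) (f : ℝ → V → E) : Prop :=
  ContDiffOn ℝ 1 (fun q : ℝ × V => f q.1 q.2) (Icc 0 T ×ˢ univ)

namespace IsC1OnSlab

variable {f : ℝ → V → E}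

theorem contDiff (hf : IsC1OnSlab T f) {t : ℝ} (ht : t ∈ Icc 0 T) : ContDiff ℝ 1 (f t) := by
  rw [← contDiffOn_univ]
  exact ContDiffOn.comp (g := fun q : ℝ × V => f q.1 q.2) hf
    (contDiff_prodMk_right t).contDiffOn fun x _ => ⟨ht, mem_univ _⟩

theorem continuousOn_time (hf : IsC1OnSlab T f) (x : V) :
    ContinuousOn (fun τ => f τ x) (Icc 0 T) :=
  (ContDiffOn.continuousOn hf).comp (f := fun τ : ℝ => (τ, x)) (by fun_prop)
    fun _ ht => ⟨ht, mem_univ _⟩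

theorem hasFDerivAt (hf : IsC1OnSlab T f) {t : ℝ} (ht : t ∈ Ioo 0 T) (x : V) :
    HasFDerivAt (fun q : ℝ × V => f q.1 q.2) (fderiv ℝ (fun q : ℝ × V => f q.1 q.2) (t, x))
      (t, x) :=
  ((ContDiffOn.contDiffAt hf (prod_mem_nhds (Icc_mem_nhds ht.1 ht.2) univ_mem)).differentiableAt
    one_ne_zero).hasFDerivAt

theorem hasDerivAt (hf : IsC1OnSlab T f) {t : ℝ} (ht : t ∈ Ioo 0 T) (x : V) :
    HasDerivAt (fun τ => f τ x) (fderiv ℝ (fun q : ℝ × V => f q.1 q.2) (t, x) (1, 0)) t :=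
  (hf.hasFDerivAt ht x).comp_hasDerivAt (f := fun τ : ℝ => (τ, x)) t
    ((hasDerivAt_id t).prodMk (hasDerivAt_const t x))

theorem differentiableAt_time (hf : IsC1OnSlab T f) {t : ℝ} (ht : t ∈ Ioo 0 T) (x : V) :
    DifferentiableAt ℝ (fun τ => f τ x) t :=
  (hf.hasDerivAt ht x).differentiableAt

theorem continuous_deriv_time (hf : IsC1OnSlab T f) {t : ℝ} (ht : t ∈ Ioo 0 T) :
    Continuous fun x => deriv (fun τ => f τ x) t := by
  simp only [fun x => (hf.hasDerivAt ht x).deriv]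
  have hcont : ContinuousOn (fderiv ℝ fun q : ℝ × V => f q.1 q.2) (Ioo 0 T ×ˢ univ) :=
    (ContDiffOn.mono hf (prod_mono_left Ioo_subset_Icc_self)).continuousOn_fderiv_of_isOpen
      (isOpen_Ioo.prod isOpen_univ) le_rfl
  exact (hcont.comp_continuous (by fun_prop) fun x => ⟨ht, mem_univ x⟩).clm_apply continuous_const

theorem fderiv_apply (hf : IsC1OnSlab T f) {t : ℝ} (ht : t ∈ Ioo 0 T) (x v : V) :
    fderiv ℝ (f t) x v = fderiv ℝ (fun q : ℝ × V => f q.1 q.2) (t, x) (0, v) := by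
  have hcomp : HasFDerivAt (f t) _ x := (hf.hasFDerivAt ht x).comp (f := fun y : V => (t, y)) x
    ((hasFDerivAt_const t x).prodMk (hasFDerivAt_id x))
  simp [hcomp.fderiv]

theorem hasDerivAt_comp_curve (hf : IsC1OnSlab T f) {X : ℝ → V} {X' : V} {t : ℝ}
    (ht : t ∈ Ioo 0 T) (hX : HasDerivAt X X' t) :
    HasDerivAt (fun τ => f τ (X τ))
      (deriv (fun τ => f τ (X t)) t + fderiv ℝ (f t) (X t) X') t := by
  refine ((hf.hasFDerivAt ht (X t)).comp_hasDerivAt (f := fun τ => (τ, X τ)) t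
    ((hasDerivAt_id t).prodMk hX)).congr_deriv ?_
  rw [(hf.hasDerivAt ht (X t)).deriv, hf.fderiv_apply ht, ← map_add]
  simp

theorem exists_lipschitzOnWith_uncurry [ProperSpace V] (hf : IsC1OnSlab T f) (x : V) (r : ℝ) :
    ∃ L : NNReal, LipschitzOnWith L (fun q : ℝ × V => f q.1 q.2)
      (Icc 0 T ×ˢ Metric.closedBall x r) :=
  (ContDiffOn.mono hf (prod_mono_right (subset_univ _))).exists_lipschitzOnWith
    one_ne_zero ((convex_Icc 0 T).prod (convex_closedBall x r))
    (isCompact_Icc.prod (isCompact_closedBall x r))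

theorem exists_lipschitzOnWith [ProperSpace V] (hf : IsC1OnSlab T f) (x : V) (r : ℝ) :
    ∃ L : NNReal, ∀ t ∈ Icc 0 T, LipschitzOnWith L (f t) (Metric.closedBall x r) := by
  obtain ⟨L, hL⟩ := hf.exists_lipschitzOnWith_uncurry x r
  refine ⟨L, fun t ht => LipschitzOnWith.of_dist_le_mul fun y hy z hz => ?_⟩
  simpa [Prod.dist_eq] using hL.dist_le_mul (t, y) ⟨ht, hy⟩ (t, z) ⟨ht, hz⟩

theorem add {g : ℝ → V → E} (hf : IsC1OnSlab T f) (hg : IsC1OnSlab T g) :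
    IsC1OnSlab T fun t x => f t x + g t x :=
  ContDiffOn.add hf hg

theorem mul {f g : ℝ → V → ℝ} (hf : IsC1OnSlab T f) (hg : IsC1OnSlab T g) :
    IsC1OnSlab T fun t x => f t x * g t x :=
  ContDiffOn.mul hf hg

theorem sum {ι : Type*} {s : Finset ι} {f : ι → ℝ → V → E}
    (hf : ∀ i ∈ s, IsC1OnSlab T (f i)) : IsC1OnSlab T fun t x => ∑ i ∈ s, f i t x :=
  ContDiffOn.sum hf

theorem coord {n : ℕ} {u : ℝ → V → Space n} (hu : IsC1OnSlab T u) (i : Fin n) :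
    IsC1OnSlab T fun t x => u t x i :=
  (EuclideanSpace.proj (𝕜 := ℝ) i).contDiff.comp_contDiffOn hu

end IsC1OnSlab

end Slab

section Gronwall

variable {E : Type*} [NormedAddCommGroup E] [NormedSpace ℝ E] {X X' : ℝ → E} {K a b : ℝ}

theorem norm_right_le_exp_mul_norm_left (hab : a ≤ b) (hc : ContinuousOn X (Icc a b))
    (hX : ∀ t ∈ Ioo a b, HasDerivAt X (X' t) t) (hK : ∀ t ∈ Ioo a b, ‖X' t‖ ≤ K * ‖X t‖) :
    ‖X b‖ ≤ Real.exp (K * (b - a)) * ‖X a‖ := by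
  obtain rfl | hab := hab.eq_or_lt
  · simp
  have hinner : ∀ c ∈ Ioo a b, ‖X b‖ ≤ Real.exp (K * (b - c)) * ‖X c‖ := by
    intro c hc'
    have hsub : Ico c b ⊆ Ioo a b := fun t ht => ⟨hc'.1.trans_le ht.1, ht.2⟩
    have h := norm_le_gronwallBound_of_norm_deriv_right_le (ε := 0)
      (hc.mono (Icc_subset_Icc_left hc'.1.le)) (fun t ht => (hX t (hsub ht)).hasDerivWithinAt)
      le_rfl (fun t ht => by simpa using hK t (hsub ht)) b (right_mem_Icc.2 hc'.2.le)
    rwa [gronwallBound_ε0, mul_comm] at h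
  have hlim : Tendsto (fun c => Real.exp (K * (b - c)) * ‖X c‖) (𝓝[>] a)
      (𝓝 (Real.exp (K * (b - a)) * ‖X a‖)) := by
    refine Tendsto.mul ?_ (((hc a (left_mem_Icc.2 hab.le)).mono_of_mem_nhdsWithin
      (mem_of_superset (Ioo_mem_nhdsGT hab) Ioo_subset_Icc_self)).norm)
    exact ((by fun_prop : Continuous fun c : ℝ => Real.exp (K * (b - c))).tendsto a).mono_left
      nhdsWithin_le_nhds
  exact ge_of_tendsto hlim (mem_of_superset (Ioo_mem_nhdsGT hab) hinner)

theorem norm_left_le_exp_mul_norm_right (hab : a ≤ b) (hc : ContinuousOn X (Icc a b))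
    (hX : ∀ t ∈ Ioo a b, HasDerivAt X (X' t) t) (hK : ∀ t ∈ Ioo a b, ‖X' t‖ ≤ K * ‖X t‖) :
    ‖X a‖ ≤ Real.exp (K * (b - a)) * ‖X b‖ := by
  have hmem : ∀ t ∈ Ioo (-b) (-a), -t ∈ Ioo a b := fun t ht =>
    ⟨by linarith [ht.2], by linarith [ht.1]⟩
  have h := norm_right_le_exp_mul_norm_left (X := fun t => X (-t)) (X' := fun t => -X' (-t))
    (K := K) (neg_le_neg hab) (hc.comp continuousOn_neg fun t ht =>
      ⟨by linarith [ht.2], by linarith [ht.1]⟩)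
    (fun t ht => by
      simpa [Function.comp_def] using (hX (-t) (hmem t ht)).scomp t (hasDerivAt_neg t))
    (fun t ht => by simpa using hK (-t) (hmem t ht))
  simpa [neg_add_eq_sub] using h

end Gronwall

section Support

theorem exists_isIntegralCurveOn {V : Type*} [NormedAddCommGroup V] [NormedSpace ℝ V]
    [ProperSpace V] {T U : ℝ} {u : ℝ → V → V} (hu : IsC1OnSlab T u)
    (hU : ∀ t ∈ Icc 0 T, ∀ x, ‖u t x‖ ≤ U) {t₁ : ℝ} (ht₁ : t₁ ∈ Icc 0 T) (x₁ : V) :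
    ∃ X : ℝ → V, X t₁ = x₁ ∧ IsIntegralCurveOn X u (Icc 0 T) := by
  have hT : 0 ≤ T := ht₁.1.trans ht₁.2
  have hU0 : 0 ≤ U := (norm_nonneg _).trans (hU t₁ ht₁ x₁)
  obtain ⟨L, hL⟩ := hu.exists_lipschitzOnWith x₁ (U * T)
  have hP : IsPicardLindelof u (tmin := 0) (tmax := T) ⟨t₁, ht₁⟩ x₁
      ⟨U * T, by positivity⟩ 0 ⟨U, hU0⟩ L := by
    refine ⟨hL, fun x _ => hu.continuousOn_time x, fun t ht x _ => hU t ht x, ?_⟩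
    simp only [NNReal.coe_zero, sub_zero]
    exact mul_le_mul_of_nonneg_left (max_le (by linarith [ht₁.1]) (by linarith [ht₁.2])) hU0
  exact hP.exists_eq_forall_mem_Icc_hasDerivWithinAt₀

theorem hasDerivAt_of_isIntegralCurveOn {V : Type*} [NormedAddCommGroup V] [NormedSpace ℝ V]
    {T t : ℝ} {u : ℝ → V → V} {X : ℝ → V} (hX : IsIntegralCurveOn X u (Icc 0 T))
    (ht : t ∈ Ioo 0 T) : HasDerivAt X (u t (X t)) t :=
  (hX t (Ioo_subset_Icc_self ht)).hasDerivAt (Icc_mem_nhds ht.1 ht.2)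

/-- The continuity equation `∂ₜ ρ + div (ρ u) = 0` on the open time interval `(0, T)`. -/
def ContinuityEquation {n : ℕ} (T : ℝ) (ρ : ℝ → Space n → ℝ) (u : ℝ → Space n → Space n) : Prop :=
  ∀ t ∈ Ioo 0 T, ∀ x, deriv (fun τ => ρ τ x) t + divergence (fun y => ρ t y • u t y) x = 0

variable {n : ℕ} {T : ℝ} {ρ : ℝ → Space n → ℝ} {u : ℝ → Space n → Space n}

theorem hasDerivAt_density_along_integralCurve (hρ : IsC1OnSlab T ρ) (hu : IsC1OnSlab T u)
    (mass : ContinuityEquation T ρ u)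
    {X : ℝ → Space n} (hX : IsIntegralCurveOn X u (Icc 0 T)) {t : ℝ} (ht : t ∈ Ioo 0 T) :
    HasDerivAt (fun τ => ρ τ (X τ)) (-(divergence (u t) (X t) * ρ t (X t))) t := by
  have ht' := Ioo_subset_Icc_self ht
  refine (hρ.hasDerivAt_comp_curve ht (hasDerivAt_of_isIntegralCurveOn hX ht)).congr_deriv ?_
  have hmass := mass t ht (X t)
  rw [divergence_smul ((hρ.contDiff ht').differentiable one_ne_zero _)
    ((hu.contDiff ht').differentiable one_ne_zero _)] at hmass
  linarith

theorem exists_abs_divergence_le (hu : IsC1OnSlab T u) (r : ℝ) :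
    ∃ A, ∀ t ∈ Icc 0 T, ∀ x ∈ Metric.ball (0 : Space n) r, |divergence (u t) x| ≤ A := by
  obtain ⟨L, hL⟩ := hu.exists_lipschitzOnWith 0 r
  refine ⟨n * L, fun t ht x hx => (abs_divergence_le
    ((hu.contDiff ht).differentiable one_ne_zero x)).trans ?_⟩
  gcongr
  exact norm_fderiv_le_of_lipschitzOn ℝ
    (mem_of_superset (Metric.isOpen_ball.mem_nhds hx) Metric.ball_subset_closedBall) (hL t ht)

theorem density_eq_zero_of_integralCurve (hρ : IsC1OnSlab T ρ) (hu : IsC1OnSlab T u)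
    (mass : ContinuityEquation T ρ u)
    {X : ℝ → Space n} (hX : IsIntegralCurveOn X u (Icc 0 T)) {t : ℝ} (ht : t ∈ Icc 0 T)
    (h0 : ρ 0 (X 0) = 0) : ρ t (X t) = 0 := by
  obtain ⟨r, hr⟩ := (isCompact_Icc.image_of_continuousOn hX.continuousOn).isBounded.subset_ball 0
  obtain ⟨A, hA⟩ := exists_abs_divergence_le hu r
  have hIcc : Icc 0 t ⊆ Icc 0 T := Icc_subset_Icc_right ht.2
  have hIoo : Ioo 0 t ⊆ Ioo 0 T := Ioo_subset_Ioo_right ht.2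
  have hgrow := norm_right_le_exp_mul_norm_left (K := A) ht.1
    ((ContDiffOn.continuousOn hρ).comp
      (continuousOn_id.prodMk (hX.continuousOn.mono hIcc)) fun τ hτ => ⟨hIcc hτ, mem_univ _⟩)
    (fun τ hτ => hasDerivAt_density_along_integralCurve hρ hu mass hX (hIoo hτ)) fun τ hτ => by
      have hτ' := Ioo_subset_Icc_self (hIoo hτ)
      rw [norm_neg, norm_mul]
      exact mul_le_mul_of_nonneg_right (hA τ hτ' _ (hr ⟨τ, hτ', rfl⟩)) (norm_nonneg _)
  simpa [h0] using hgrow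

theorem norm_integralCurve_sub_le {V : Type*} [NormedAddCommGroup V] [NormedSpace ℝ V] {T U t : ℝ}
    {u : ℝ → V → V} (hU : ∀ t ∈ Icc 0 T, ∀ x, ‖u t x‖ ≤ U) {X : ℝ → V}
    (hX : IsIntegralCurveOn X u (Icc 0 T)) (ht : t ∈ Icc 0 T) : ‖X t - X 0‖ ≤ U * t := by
  have h := (convex_Icc 0 T).norm_image_sub_le_of_norm_hasDerivWithin_le hX
    (fun s hs => hU s hs _) ⟨le_rfl, ht.1.trans ht.2⟩ ht
  rwa [sub_zero, Real.norm_of_nonneg ht.1] at h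

theorem density_eq_zero_of_norm_gt_add (hρ : IsC1OnSlab T ρ) (hu : IsC1OnSlab T u)
    (mass : ContinuityEquation T ρ u) {R₀ U : ℝ}
    (hU : ∀ t ∈ Icc 0 T, ∀ x, ‖u t x‖ ≤ U) (h0 : ∀ x, R₀ < ‖x‖ → ρ 0 x = 0) :
    ∀ t ∈ Icc 0 T, ∀ x, R₀ + U * T < ‖x‖ → ρ t x = 0 := by
  intro t ht x hx
  obtain ⟨X, rfl, hX⟩ := exists_isIntegralCurveOn hu hU ht x
  refine density_eq_zero_of_integralCurve hρ hu mass hX ht (h0 _ ?_)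
  have hUt : U * t ≤ U * T := mul_le_mul_of_nonneg_left ht.2 ((norm_nonneg _).trans (hU t ht 0))
  linarith [norm_integralCurve_sub_le hU hX ht, norm_le_norm_add_norm_sub' (X t) (X 0)]

theorem eq_zero_of_norm_eq_of_forall_norm_gt {V E : Type*} [NormedAddCommGroup V]
    [NormedSpace ℝ V] [NormedAddCommGroup E] {f : V → E} (hf : Continuous f) {r : ℝ} (hr : r ≠ 0)
    (hout : ∀ x, r < ‖x‖ → f x = 0) {p : V} (hp : ‖p‖ = r) : f p = 0 := by
  have hEq : EqOn f 0 (closure (Metric.closedBall 0 r)ᶜ) :=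
    EqOn.closure (fun y hy => hout y (by simpa using hy)) hf continuous_const
  exact hEq (by simp [closure_compl, interior_closedBall _ hr, hp])

/-- The points of the sphere of radius `r` are at rest, so an integral curve approaches the sphere
at most exponentially fast. -/
theorem sub_norm_zero_le_exp_mul_sub_norm {V : Type*} [NormedAddCommGroup V] [NormedSpace ℝ V]
    {T r t : ℝ} {L : NNReal} {u : ℝ → V → V} (hcont : ∀ t ∈ Ioo 0 T, Continuous (u t))
    (hL : ∀ t ∈ Icc 0 T, LipschitzOnWith L (u t) (Metric.closedBall 0 r))
    (hout : ∀ t ∈ Ioo 0 T, ∀ x, r < ‖x‖ → u t x = 0) {X : ℝ → V}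
    (hX : IsIntegralCurveOn X u (Icc 0 T)) (ht : t ∈ Icc 0 T) (hpos : 0 < ‖X t‖)
    (hle : ‖X t‖ ≤ r) : r - ‖X 0‖ ≤ Real.exp (L * T) * (r - ‖X t‖) := by
  have hr : 0 < r := hpos.trans_le hle
  set p : V := (r / ‖X t‖) • X t with hp
  have hp_norm : ‖p‖ = r := by
    rw [hp, norm_smul, Real.norm_of_nonneg (by positivity), div_mul_cancel₀ _ hpos.ne']
  have hXp : ‖X t - p‖ = r - ‖X t‖ := by
    have hscale : X t - p = (1 - r / ‖X t‖) • X t := by rw [sub_smul, one_smul]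
    rw [hscale, norm_smul, Real.norm_of_nonpos (sub_nonpos.2 ((one_le_div hpos).2 hle)), neg_sub,
      sub_mul, div_mul_cancel₀ _ hpos.ne', one_mul]
  have hup : ∀ s ∈ Ioo 0 T, u s p = 0 := fun s hs =>
    eq_zero_of_norm_eq_of_forall_norm_gt (hcont s hs) hr.ne' (hout s hs) hp_norm
  have hbound : ∀ s ∈ Ioo 0 T, ‖u s (X s)‖ ≤ L * ‖X s - p‖ := by
    intro s hs
    rcases lt_or_ge r ‖X s‖ with hXs | hXs
    · simpa [hout s hs _ hXs] using mul_nonneg L.2 (norm_nonneg (X s - p))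
    · simpa [hup s hs, dist_eq_norm] using (hL s (Ioo_subset_Icc_self hs)).dist_le_mul (X s)
        (by simpa using hXs) p (by simp [hp_norm])
  have hIoo : Ioo 0 t ⊆ Ioo 0 T := Ioo_subset_Ioo_right ht.2
  calc r - ‖X 0‖ ≤ ‖X 0 - p‖ := by rw [← hp_norm, norm_sub_rev]; exact norm_sub_norm_le p (X 0)
    _ ≤ Real.exp (L * (t - 0)) * ‖X t - p‖ :=
        norm_left_le_exp_mul_norm_right (X := fun s => X s - p) ht.1
          ((hX.continuousOn.mono (Icc_subset_Icc_right ht.2)).sub continuousOn_const)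
          (fun s hs => (hasDerivAt_of_isIntegralCurveOn hX (hIoo hs)).sub_const p)
          fun s hs => hbound s (hIoo hs)
    _ ≤ Real.exp (L * T) * (r - ‖X t‖) := by
        rw [hXp, sub_zero]
        gcongr
        exact ht.2

/-- If the gas stays in the ball of radius `R₀ + d`, then it stays in a strictly smaller one, since
otherwise it would have reached the sphere of radius `R₀ + d` too fast. -/
theorem density_eq_zero_of_norm_gt_contraction (hρ : IsC1OnSlab T ρ) (hu : IsC1OnSlab T u)
    (mass : ContinuityEquation T ρ u) {R₀ U d : ℝ} {L : NNReal}
    (hU : ∀ t ∈ Icc 0 T, ∀ x, ‖u t x‖ ≤ U) (hR₀ : 0 ≤ R₀) (h0 : ∀ x, R₀ < ‖x‖ → ρ 0 x = 0)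
    (hvac : ∀ t ∈ Ioo 0 T, ∀ r ≥ 0, (∀ x, r < ‖x‖ → ρ t x = 0) → ∀ x, r < ‖x‖ → u t x = 0)
    (hL : ∀ t ∈ Icc 0 T, LipschitzOnWith L (u t) (Metric.closedBall 0 (R₀ + d))) (hd : 0 ≤ d)
    (hout : ∀ t ∈ Icc 0 T, ∀ x, R₀ + d < ‖x‖ → ρ t x = 0) :
    ∀ t ∈ Icc 0 T, ∀ x, R₀ + (1 - Real.exp (-(L * T))) * d < ‖x‖ → ρ t x = 0 := by
  intro t ht x hx
  rcases lt_or_ge (R₀ + d) ‖x‖ with hdx | hdx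
  · exact hout t ht x hdx
  have hshrink : 0 ≤ (1 - Real.exp (-(L * T))) * d := mul_nonneg (sub_nonneg.2
    (Real.exp_le_one_iff.2 (neg_nonpos.2 (mul_nonneg L.2 (ht.1.trans ht.2))))) hd
  obtain ⟨X, rfl, hX⟩ := exists_isIntegralCurveOn hu hU ht x
  refine density_eq_zero_of_integralCurve hρ hu mass hX ht (h0 _ ?_)
  have hexit := sub_norm_zero_le_exp_mul_sub_norm
    (fun s hs => (hu.contDiff (Ioo_subset_Icc_self hs)).continuous) hL
    (fun s hs => hvac s hs _ (by linarith) (hout s (Ioo_subset_Icc_self hs))) hX ht (by linarith)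
    hdx
  have hlt : Real.exp (L * T) * (R₀ + d - ‖X t‖) < d := by
    rw [← lt_div_iff₀' (Real.exp_pos _), div_eq_mul_inv, ← Real.exp_neg]
    linarith
  linarith

theorem density_eq_zero_of_norm_gt (hρ : IsC1OnSlab T ρ) (hu : IsC1OnSlab T u)
    (mass : ContinuityEquation T ρ u) {R₀ U : ℝ}
    (hU : ∀ t ∈ Icc 0 T, ∀ x, ‖u t x‖ ≤ U) (hR₀ : 0 ≤ R₀) (h0 : ∀ x, R₀ < ‖x‖ → ρ 0 x = 0)
    (hvac : ∀ t ∈ Ioo 0 T, ∀ r ≥ 0, (∀ x, r < ‖x‖ → ρ t x = 0) → ∀ x, r < ‖x‖ → u t x = 0) :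
    ∀ t ∈ Icc 0 T, ∀ x, R₀ < ‖x‖ → ρ t x = 0 := by
  intro t ht
  set d₀ := U * T
  have hd₀_nonneg : 0 ≤ d₀ :=
    mul_nonneg ((norm_nonneg _).trans (hU t ht 0)) (ht.1.trans ht.2)
  obtain ⟨L, hL⟩ := hu.exists_lipschitzOnWith 0 (R₀ + d₀)
  set q := 1 - Real.exp (-(L * T))
  have hq_nonneg : 0 ≤ q := sub_nonneg.2 (Real.exp_le_one_iff.2
    (neg_nonpos.2 (mul_nonneg L.2 (ht.1.trans ht.2))))
  have hq_lt : q < 1 := sub_lt_self _ (Real.exp_pos _)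
  have hiter : ∀ k : ℕ, ∀ s ∈ Icc 0 T, ∀ x, R₀ + q ^ k * d₀ < ‖x‖ → ρ s x = 0 := by
    intro k
    induction k with
    | zero => simpa using density_eq_zero_of_norm_gt_add hρ hu mass hU h0
    | succ k ih =>
      have hle : q ^ k * d₀ ≤ d₀ :=
        mul_le_of_le_one_left hd₀_nonneg (pow_le_one₀ hq_nonneg hq_lt.le)
      rw [pow_succ', mul_assoc]
      exact density_eq_zero_of_norm_gt_contraction hρ hu mass hU hR₀ h0 hvac
        (fun s hs => (hL s hs).mono (Metric.closedBall_subset_closedBall (by linarith)))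
        (by positivity) ih
  intro x hx
  have hlim : Tendsto (fun k => R₀ + q ^ k * d₀) atTop (𝓝 R₀) := by
    simpa using ((tendsto_pow_atTop_nhds_zero_of_lt_one hq_nonneg hq_lt).mul_const d₀).const_add R₀
  obtain ⟨k, hk⟩ := (hlim.eventually_lt_const hx).exists
  exact hiter k t ht x hk

end Support

section Stress

variable {n : ℕ}

/-- Twice the rate-of-strain tensor, `∂ⱼ vᵢ + ∂ᵢ vⱼ`. -/
def deformation (v : Space n → Space n) (i j : Fin n) (x : Space n) : ℝ :=
  pderiv j (fun y => v y i) x + pderiv i (fun y => v y j) x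

/-- The rate `∇v : 𝒯` at which viscosity turns kinetic energy into heat. -/
def dissipation (μ lam : ℝ) (v : Space n → Space n) (x : Space n) : ℝ :=
  ∑ i, ∑ j, pderiv j (fun y => v y i) x * stress μ lam v i j x

theorem contDiff_stress {v : Space n → Space n} (hv : ContDiff ℝ 2 v) (μ lam : ℝ) (i j : Fin n) :
    ContDiff ℝ 1 (stress μ lam v i j) := by
  have hgrad : ∀ i j, ContDiff ℝ 1 (pderiv j fun y => v y i) := fun i j =>
    contDiff_pderiv (contDiff_coord hv i) (by norm_num) j
  have hdiv : ContDiff ℝ 1 fun x => if i = j then lam * divergence v x else 0 := by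
    split_ifs
    · exact contDiff_const.mul (ContDiff.sum fun k _ => hgrad k k)
    · exact contDiff_const
  exact (contDiff_const.mul ((hgrad i j).add (hgrad j i))).add hdiv

theorem stress_eq_zero_of_eventuallyEq {v : Space n → Space n} {x : Space n} (hv : v =ᶠ[𝓝 x] 0)
    (μ lam : ℝ) (i j : Fin n) : stress μ lam v i j x = 0 := by
  have hgrad : ∀ i j, pderiv j (fun y => v y i) x = 0 := fun i j =>
    pderiv_eq_zero_of_eventuallyEq (hv.mono fun y hy => by simp [hy]) j
  simp [stress, divergence, hgrad]

theorem sum_stress_diag (μ lam : ℝ) (v : Space n → Space n) (x : Space n) :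
    ∑ i, stress μ lam v i i x = (2 * μ + n * lam) * divergence v x := by
  simp only [stress, if_true, Finset.sum_add_distrib, ← Finset.mul_sum, Finset.sum_const,
    Finset.card_univ, Fintype.card_fin, nsmul_eq_mul, divergence]
  ring

theorem divergence_stress_velocity {v : Space n → Space n} (hv : ContDiff ℝ 2 v) (μ lam : ℝ)
    (x : Space n) :
    ∑ j, pderiv j (fun y => ∑ i, v y i * stress μ lam v i j y) x
      = dissipation μ lam v x + ∑ i, v x i * ∑ j, pderiv j (stress μ lam v i j) x := by
  have hv' : ∀ i, DifferentiableAt ℝ (fun y => v y i) x := fun i =>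
    (contDiff_coord hv i).differentiable two_ne_zero x
  have hstress : ∀ i j, DifferentiableAt ℝ (stress μ lam v i j) x := fun i j =>
    (contDiff_stress hv μ lam i j).differentiable one_ne_zero x
  simp only [pderiv_sum fun i _ => (hv' i).fun_mul (hstress i _), dissipation, Finset.mul_sum]
  rw [Finset.sum_comm, ← Finset.sum_add_distrib]
  refine Finset.sum_congr rfl fun i _ => ?_
  rw [← Finset.sum_add_distrib]
  refine Finset.sum_congr rfl fun j _ => ?_
  rw [pderiv_mul (hv' i) (hstress i j)]
  ring

theorem dissipation_eq (μ lam : ℝ) (v : Space n → Space n) (x : Space n) :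
    dissipation μ lam v x
      = μ / 2 * ∑ i, ∑ j, deformation v i j x ^ 2 + lam * divergence v x ^ 2 := by
  set a : Fin n → Fin n → ℝ := fun i j => pderiv j (fun y => v y i) x
  have htrace : ∑ i, ∑ j, a i j * (if i = j then lam * divergence v x else 0)
      = lam * divergence v x ^ 2 := by
    simp only [mul_ite, mul_zero, Finset.sum_ite_eq, Finset.mem_univ, if_true, ← Finset.sum_mul]
    rw [show ∑ i, a i i = divergence v x from rfl]
    ring
  have hswap : ∑ i, ∑ j, a i j * deformation v i j x = ∑ i, ∑ j, a j i * deformation v i j x := by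
    rw [Finset.sum_comm]
    simp only [deformation, add_comm]
  have hsymm : ∑ i, ∑ j, a i j * (μ * deformation v i j x)
      = μ / 2 * ∑ i, ∑ j, deformation v i j x ^ 2 := by
    have hsq : ∑ i, ∑ j, deformation v i j x ^ 2
        = ∑ i, ∑ j, a i j * deformation v i j x + ∑ i, ∑ j, a j i * deformation v i j x := by
      simp only [← Finset.sum_add_distrib, ← add_mul, sq]
      rfl
    rw [hsq, ← hswap]
    simp only [mul_left_comm _ μ, ← Finset.mul_sum]
    ring
  rw [← hsymm, ← htrace]
  simp only [← Finset.sum_add_distrib, ← mul_add]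
  rfl

theorem divergence_sq_le (v : Space n → Space n) (x : Space n) :
    divergence v x ^ 2 ≤ n / 4 * ∑ i, ∑ j, deformation v i j x ^ 2 := by
  set d : Fin n → ℝ := fun i => pderiv i (fun y => v y i) x
  have hdiag : ∀ i, 4 * d i ^ 2 ≤ ∑ j, deformation v i j x ^ 2 := by
    intro i
    calc 4 * d i ^ 2 = deformation v i i x ^ 2 := by simp only [deformation, d]; ring
      _ ≤ _ := Finset.single_le_sum (f := fun j => deformation v i j x ^ 2)
        (fun j _ => sq_nonneg _) (Finset.mem_univ i)
  calc divergence v x ^ 2 ≤ n * ∑ i, d i ^ 2 := by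
        simpa [divergence, d] using sq_sum_le_card_mul_sum_sq (s := Finset.univ) (f := d)
    _ = n / 4 * ∑ i, 4 * d i ^ 2 := by rw [← Finset.mul_sum]; ring
    _ ≤ _ := by gcongr with i; exact hdiag i

theorem exists_mul_sum_deformation_sq_le_dissipation {μ lam : ℝ} (hμ : 0 < μ)
    (hlam : 0 < 2 * μ + n * lam) :
    ∃ c > 0, ∀ (v : Space n → Space n) (x : Space n),
      c * ∑ i, ∑ j, deformation v i j x ^ 2 ≤ dissipation μ lam v x := by
  refine ⟨min (μ / 2) ((2 * μ + n * lam) / 4), lt_min (by positivity) (by positivity),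
    fun v x => ?_⟩
  rw [dissipation_eq]
  have hS : 0 ≤ ∑ i, ∑ j, deformation v i j x ^ 2 :=
    Finset.sum_nonneg fun i _ => Finset.sum_nonneg fun j _ => sq_nonneg _
  rcases le_total 0 lam with h | h
  · have hdiv : 0 ≤ lam * divergence v x ^ 2 := by positivity
    linarith [mul_le_mul_of_nonneg_right (min_le_left (μ / 2) ((2 * μ + n * lam) / 4)) hS]
  · have hdiv := mul_le_mul_of_nonpos_left (divergence_sq_le v x) h
    linarith [mul_le_mul_of_nonneg_right (min_le_right (μ / 2) ((2 * μ + n * lam) / 4)) hS]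

theorem dissipation_nonneg {μ lam : ℝ} (hμ : 0 < μ) (hlam : 0 < 2 * μ + n * lam)
    (v : Space n → Space n) (x : Space n) : 0 ≤ dissipation μ lam v x := by
  obtain ⟨c, hc, hle⟩ := exists_mul_sum_deformation_sq_le_dissipation hμ hlam
  exact le_trans (by positivity) (hle v x)

theorem deformation_eq_zero_of_dissipation_eq_zero {μ lam : ℝ} (hμ : 0 < μ)
    (hlam : 0 < 2 * μ + n * lam) {v : Space n → Space n} {x : Space n}
    (h : dissipation μ lam v x = 0) (i j : Fin n) : deformation v i j x = 0 := by
  obtain ⟨c, hc, hle⟩ := exists_mul_sum_deformation_sq_le_dissipation hμ hlam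
  have hS : ∑ i, ∑ j, deformation v i j x ^ 2 = 0 :=
    le_antisymm (nonpos_of_mul_nonpos_right ((hle v x).trans h.le) hc) (by positivity)
  rw [Finset.sum_eq_zero_iff_of_nonneg fun i _ => by positivity] at hS
  have hrow := hS i (Finset.mem_univ i)
  rw [Finset.sum_eq_zero_iff_of_nonneg fun j _ => sq_nonneg _] at hrow
  exact pow_eq_zero_iff two_ne_zero |>.1 (hrow j (Finset.mem_univ j))

end Stress

section HalfSpace

variable {V : Type*} [NormedAddCommGroup V] [InnerProductSpace ℝ V] [FiniteDimensional ℝ V]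
  [MeasurableSpace V] [BorelSpace V] (ν : Measure V) [ν.IsAddHaarMeasure]

theorem measure_halfSpace {x : V} (hx : x ≠ 0) (a : ℝ) : ν {y | a < ⟪x, y⟫_ℝ} = ⊤ := by
  have : Nontrivial V := nontrivial_of_ne x 0 hx
  have : NoncompactSpace V := NormedSpace.noncompactSpace ℝ V
  have htranslate : ∀ b, ν {y | b < ⟪x, y⟫_ℝ} = ν {y | a < ⟪x, y⟫_ℝ} := by
    intro b
    have hx' : ‖x‖ ^ 2 ≠ 0 := by positivity
    rw [← measure_preimage_add_right ν (((b - a) / ‖x‖ ^ 2) • x)]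
    congr 1
    ext y
    simp only [mem_preimage, mem_ofPred_eq, inner_add_right, real_inner_smul_right,
      real_inner_self_eq_norm_sq, div_mul_cancel₀ _ hx']
    constructor <;> intro h <;> linarith
  have hunion : (⋃ k : ℕ, {y | -(k : ℝ) < ⟪x, y⟫_ℝ}) = univ := eq_univ_of_forall fun y => by
    obtain ⟨k, hk⟩ := exists_nat_gt (-⟪x, y⟫_ℝ)
    exact mem_iUnion.2 ⟨k, neg_lt.1 hk⟩
  have hmono : Monotone fun k : ℕ => {y | -(k : ℝ) < ⟪x, y⟫_ℝ} := by
    intro k l hkl y (hy : -(k : ℝ) < ⟪x, y⟫_ℝ)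
    exact (neg_le_neg (Nat.cast_le.2 hkl)).trans_lt hy
  calc ν {y | a < ⟪x, y⟫_ℝ} = ⨆ k : ℕ, ν {y | -(k : ℝ) < ⟪x, y⟫_ℝ} := by simp [htranslate]
    _ = ν univ := by rw [← hmono.measure_iUnion, hunion]
    _ = ⊤ := measure_univ_of_isAddLeftInvariant ν

variable {ν}

theorem eq_zero_of_memLp_of_eq_on_halfSpace {F : Type*} [NormedAddCommGroup F] {p : ENNReal}
    (hp₀ : p ≠ 0) (hp : p ≠ ⊤) {g : V → F} (hg : MemLp g p ν) {x : V} (hx : x ≠ 0) {a : ℝ} {c : F}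
    (hc : ∀ y, a < ⟪x, y⟫_ℝ → g y = c) : c = 0 := by
  have hmeas : MeasurableSet {y | a < ⟪x, y⟫_ℝ} :=
    (isOpen_lt continuous_const (by fun_prop)).measurableSet
  have hconst : MemLp (fun _ => c) p (ν.restrict {y | a < ⟪x, y⟫_ℝ}) :=
    (hg.restrict _).ae_eq ((ae_restrict_mem hmeas).mono hc)
  rw [memLp_const_iff hp₀ hp, Measure.restrict_apply_univ, measure_halfSpace ν hx] at hconst
  exact hconst.resolve_right (lt_irrefl _)

theorem eq_zero_on_halfSpace_of_fderiv_eq {F : Type*} [NormedAddCommGroup F] [NormedSpace ℝ F]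
    {p : ENNReal} (hp₀ : p ≠ 0) (hp : p ≠ ⊤) {f : V → F} (hf : Differentiable ℝ f)
    (hfp : MemLp f p ν) {x : V} (hx : x ≠ 0) {a : ℝ} {f' : V →L[ℝ] F}
    (hf' : ∀ y, a < ⟪x, y⟫_ℝ → fderiv ℝ f y = f') {y : V} (hy : a < ⟪x, y⟫_ℝ) : f y = 0 := by
  have haffine : ∀ z w, a < ⟪x, z⟫_ℝ → a < ⟪x, w⟫_ℝ → f w - f z = f' (w - z) := by
    intro z w hz hw
    have hconst := (isOpen_lt (continuous_const (y := a)) (by fun_prop)).is_const_of_fderiv_eq_zero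
      (𝕜 := ℝ) (convex_halfSpace_gt (innerSL ℝ x).toLinearMap.isLinear a).isPreconnected
      (hf.sub f'.differentiable).differentiableOn
      (fun v hv => by
        simp [fderiv_sub hf.differentiableAt f'.differentiableAt, hf' v hv]) hz hw
    simp only [Pi.sub_apply] at hconst
    rw [map_sub, sub_eq_sub_iff_sub_eq_sub, hconst]
  have hshift : ∀ w, 0 ≤ ⟪x, w⟫_ℝ → f' w = 0 := by
    intro w hw
    have hdiff : MemLp (fun z => f (z + w) - f z) p ν :=
      (hfp.comp_measurePreserving (measurePreserving_add_right ν w)).sub hfp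
    refine eq_zero_of_memLp_of_eq_on_halfSpace hp₀ hp hdiff hx (a := a) fun z hz => ?_
    rw [haffine z (z + w) hz (by rw [inner_add_right]; linarith), add_sub_cancel_left]
  have hzero : f' = 0 := by
    ext w
    rcases le_total 0 ⟪x, w⟫_ℝ with hw | hw
    · exact hshift w hw
    · simpa using hshift (-w) (by simpa [inner_neg_right] using hw)
  refine eq_zero_of_memLp_of_eq_on_halfSpace hp₀ hp hfp hx (a := a) fun z hz => ?_
  simpa [hzero, sub_eq_zero] using haffine y z hy hz

end HalfSpace

section RigidMotion

variable {n : ℕ}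

theorem pderiv_pderiv {f : Space n → ℝ} (hf : ContDiff ℝ 2 f) (i j : Fin n) (x : Space n) :
    pderiv i (pderiv j f) x
      = fderiv ℝ (fderiv ℝ f) x (EuclideanSpace.single i 1) (EuclideanSpace.single j 1) := by
  have hdiff := (hf.fderiv_right (m := 1) (by norm_num)).differentiable one_ne_zero x
  have hclm := hdiff.hasFDerivAt.clm_apply
    (hasFDerivAt_const (EuclideanSpace.single j (1 : ℝ) : Space n) x)
  rw [pderiv, show pderiv j f = fun y => fderiv ℝ f y (EuclideanSpace.single j 1) from rfl,
    hclm.fderiv]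
  simp

theorem pderiv_comm {f : Space n → ℝ} (hf : ContDiff ℝ 2 f) (i j : Fin n) (x : Space n) :
    pderiv i (pderiv j f) x = pderiv j (pderiv i f) x := by
  rw [pderiv_pderiv hf, pderiv_pderiv hf, (hf.contDiffAt (x := x)).isSymmSndFDerivAt (by simp)]

theorem fderiv_eq_zero_of_pderiv_eq_zero {f : Space n → ℝ} {x : Space n}
    (h : ∀ j, pderiv j f x = 0) : fderiv ℝ f x = 0 := by
  ext v
  simp [fderiv_apply_eq_sum_pderiv, h]

/-- The second derivatives `∂ₖ∂ⱼ vᵢ` are symmetric in `j, k` and antisymmetric in `i, j`, so they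
vanish. -/
theorem pderiv_pderiv_eq_zero_of_deformation_eq_zero {v : Space n → Space n}
    (hv : ContDiff ℝ 2 v) {Ω : Set (Space n)} (hΩ : IsOpen Ω)
    (h : ∀ x ∈ Ω, ∀ i j, deformation v i j x = 0) {x : Space n} (hx : x ∈ Ω) (i j k : Fin n) :
    pderiv k (pderiv j fun y => v y i) x = 0 := by
  have hsymm : ∀ i j k,
      pderiv k (pderiv j fun y => v y i) x = pderiv j (pderiv k fun y => v y i) x :=
    fun i j k => pderiv_comm (contDiff_coord hv i) k j x
  have hanti : ∀ i j k,
      pderiv k (pderiv j fun y => v y i) x + pderiv k (pderiv i fun y => v y j) x = 0 := by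
    intro i j k
    have hdiff : ∀ i j, DifferentiableAt ℝ (pderiv j fun y => v y i) x := fun i j =>
      (contDiff_pderiv (contDiff_coord hv i) (l := 1) (by norm_num) j).differentiable one_ne_zero x
    rw [← pderiv_add (hdiff i j) (hdiff j i) k]
    refine pderiv_eq_zero_of_eventuallyEq ?_ k
    filter_upwards [hΩ.mem_nhds hx] with y hy using h y hy i j
  linarith [hanti i j k, hsymm j i k, hanti j k i, hsymm k j i, hanti k i j, hsymm i k j]

theorem fderiv_eq_of_deformation_eq_zero {v : Space n → Space n} (hv : ContDiff ℝ 2 v)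
    {Ω : Set (Space n)} (hΩ : IsOpen Ω) (hconn : IsPreconnected Ω)
    (h : ∀ x ∈ Ω, ∀ i j, deformation v i j x = 0) {x y : Space n} (hx : x ∈ Ω) (hy : y ∈ Ω) :
    fderiv ℝ v x = fderiv ℝ v y := by
  ext w i
  have hv' : ∀ z, DifferentiableAt ℝ v z := hv.differentiable two_ne_zero
  have hcoord : ∀ z, fderiv ℝ v z w i = fderiv ℝ (fun y => v y i) z w := fun z => by
    have hcomp : HasFDerivAt (fun y => v y i) _ z :=
      (EuclideanSpace.proj (𝕜 := ℝ) i).hasFDerivAt.comp z (hv' z).hasFDerivAt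
    rw [hcomp.fderiv]
    rfl
  simp only [hcoord, fderiv_apply_eq_sum_pderiv]
  refine Finset.sum_congr rfl fun j _ => ?_
  congr 1
  exact hΩ.is_const_of_fderiv_eq_zero (𝕜 := ℝ) hconn
    ((contDiff_pderiv (contDiff_coord hv i) (l := 1) (by norm_num) j).differentiable
      one_ne_zero).differentiableOn
    (fun z hz => fderiv_eq_zero_of_pderiv_eq_zero fun k =>
      pderiv_pderiv_eq_zero_of_deformation_eq_zero hv hΩ h hz i j k) hx hy

theorem eq_zero_of_deformation_eq_zero_of_memLp {v : Space n → Space n} (hv : ContDiff ℝ 2 v)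
    {p : ENNReal} (hp₀ : p ≠ 0) (hp : p ≠ ⊤) (hvp : MemLp v p) {r : ℝ} (hr : 0 ≤ r)
    (h : ∀ x, r < ‖x‖ → ∀ i j, deformation v i j x = 0) {x : Space n} (hx : r < ‖x‖) :
    v x = 0 := by
  have hx0 : 0 < ‖x‖ := hr.trans_lt hx
  have hxx : r * ‖x‖ < ⟪x, x⟫_ℝ := by
    rw [real_inner_self_eq_norm_mul_norm]
    gcongr
  have hout : ∀ y, r * ‖x‖ < ⟪x, y⟫_ℝ → r < ‖y‖ := fun y hy =>
    lt_of_mul_lt_mul_right (hy.trans_le ((real_inner_le_norm x y).trans_eq (mul_comm _ _))) hx0.le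
  exact eq_zero_on_halfSpace_of_fderiv_eq hp₀ hp (hv.differentiable two_ne_zero) hvp
    (norm_pos_iff.1 hx0) (f' := fderiv ℝ v x) (fun y hy =>
      fderiv_eq_of_deformation_eq_zero hv (isOpen_lt (continuous_const (y := r * ‖x‖))
          (by fun_prop : Continuous fun y => ⟪x, y⟫_ℝ))
        (convex_halfSpace_gt (innerSL ℝ x).toLinearMap.isLinear _).isPreconnected
        (fun z hz => h z (hout z hz)) hy hxx) hxx

end RigidMotion

section IntegrationByParts

variable {n : ℕ}

theorem hasCompactSupport_pderiv {f : Space n → ℝ} (hf : HasCompactSupport f) (j : Fin n) :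
    HasCompactSupport (pderiv j f) :=
  hf.fderiv_apply (𝕜 := ℝ) (EuclideanSpace.single j 1)

theorem integral_mul_pderiv {f g : Space n → ℝ} (hf : ContDiff ℝ 1 f) (hg : ContDiff ℝ 1 g)
    (hgc : HasCompactSupport g) (j : Fin n) :
    ∫ x, g x * pderiv j f x = -∫ x, pderiv j g x * f x := by
  refine integral_mul_fderiv_eq_neg_fderiv_mul_of_integrable (v := EuclideanSpace.single j 1)
    ?_ ?_ ?_ (fun x _ => hg.differentiable one_ne_zero x)
    (fun x _ => hf.differentiable one_ne_zero x)
  · exact ((continuous_pderiv hg j).mul hf.continuous).integrable_of_hasCompactSupport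
      (hasCompactSupport_pderiv hgc j).mul_right
  · exact (hg.continuous.mul (continuous_pderiv hf j)).integrable_of_hasCompactSupport hgc.mul_right
  · exact (hg.continuous.mul hf.continuous).integrable_of_hasCompactSupport hgc.mul_right

theorem integral_pderiv_eq_zero {f : Space n → ℝ} (hf : ContDiff ℝ 1 f)
    (hfc : HasCompactSupport f) (j : Fin n) : ∫ x, pderiv j f x = 0 := by
  have hparts := integral_mul_pderiv (contDiff_const (c := (1 : ℝ))) hf hfc j
  simpa [pderiv] using hparts.symm

theorem integrable_pderiv {f : Space n → ℝ} (hf : ContDiff ℝ 1 f) (hfc : HasCompactSupport f)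
    (j : Fin n) : Integrable (pderiv j f) :=
  (continuous_pderiv hf j).integrable_of_hasCompactSupport (hasCompactSupport_pderiv hfc j)

theorem integral_sum_pderiv_eq_zero {w : Fin n → Space n → ℝ} (hw : ∀ j, ContDiff ℝ 1 (w j))
    (hwc : ∀ j, HasCompactSupport (w j)) : ∫ x, ∑ j, pderiv j (w j) x = 0 := by
  rw [integral_finsetSum _ fun j _ => integrable_pderiv (hw j) (hwc j) j]
  exact Finset.sum_eq_zero fun j _ => integral_pderiv_eq_zero (hw j) (hwc j) j

theorem integral_coord_mul_pderiv {f : Space n → ℝ} (hf : ContDiff ℝ 1 f)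
    (hfc : HasCompactSupport f) (i j : Fin n) :
    ∫ x, x i * pderiv j f x = -if i = j then ∫ x, f x else 0 := by
  have hcoord : ContDiff ℝ 1 fun x : Space n => x i := contDiff_coord contDiff_id i
  have hparts := integral_mul_pderiv hcoord hf hfc j
  simp only [pderiv_coordinate, mul_comm (f _), mul_comm (pderiv j f _)] at hparts ⊢
  rw [← neg_eq_iff_eq_neg.2 hparts]
  split_ifs <;> simp

theorem integral_sum_coord_mul_sum_pderiv {S : Fin n → Fin n → Space n → ℝ}
    (hS : ∀ i j, ContDiff ℝ 1 (S i j)) (hSc : ∀ i j, HasCompactSupport (S i j)) :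
    ∫ x, ∑ i, x i * ∑ j, pderiv j (S i j) x = -∫ x, ∑ i, S i i x := by
  have hint : ∀ i j, Integrable fun x : Space n => x i * pderiv j (S i j) x := fun i j =>
    ((EuclideanSpace.proj (𝕜 := ℝ) i).continuous.mul
      (continuous_pderiv (hS i j) j)).integrable_of_hasCompactSupport
      (hasCompactSupport_pderiv (hSc i j) j).mul_left
  simp only [Finset.mul_sum]
  rw [integral_finsetSum _ fun i _ => integrable_finsetSum _ fun j _ => hint i j,
    integral_finsetSum _ fun i _ =>
      (hS i i).continuous.integrable_of_hasCompactSupport (hSc i i), ← Finset.sum_neg_distrib]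
  refine Finset.sum_congr rfl fun i _ => ?_
  rw [integral_finsetSum _ fun j _ => hint i j]
  simp [integral_coord_mul_pderiv (hS i _) (hSc i _)]

end IntegrationByParts

section Laplacian

variable {n : ℕ}

theorem laplacian_eq_sum_pderiv {f : Space n → ℝ} (hf : ContDiff ℝ 2 f) (x : Space n) :
    Laplacian.laplacian f x = ∑ j, pderiv j (pderiv j f) x := by
  rw [InnerProductSpace.laplacian_eq_iteratedFDeriv_orthonormalBasis f
    (EuclideanSpace.basisFun (Fin n) ℝ)]
  refine Finset.sum_congr rfl fun j _ => ?_
  rw [pderiv_pderiv hf, iteratedFDeriv_two_apply]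
  simp

theorem continuous_laplacian {f : Space n → ℝ} (hf : ContDiff ℝ 2 f) :
    Continuous fun x => Laplacian.laplacian f x := by
  simp only [laplacian_eq_sum_pderiv hf]
  exact continuous_finsetSum _ fun j _ =>
    continuous_pderiv (contDiff_pderiv hf (by norm_num) j) j

theorem integral_mul_laplacian {f g : Space n → ℝ} (hf : ContDiff ℝ 2 f) (hg : ContDiff ℝ 1 g)
    (hgc : HasCompactSupport g) :
    ∫ x, g x * Laplacian.laplacian f x = -∑ j, ∫ x, pderiv j g x * pderiv j f x := by
  have hp : ∀ j, ContDiff ℝ 1 (pderiv j f) := fun j => contDiff_pderiv hf (by norm_num) j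
  simp only [laplacian_eq_sum_pderiv hf, Finset.mul_sum]
  have hint : ∀ j, Integrable fun x => g x * pderiv j (pderiv j f) x := fun j =>
    (hg.continuous.mul (continuous_pderiv (hp j) j)).integrable_of_hasCompactSupport hgc.mul_right
  rw [integral_finsetSum _ fun j _ => hint j, ← Finset.sum_neg_distrib]
  exact Finset.sum_congr rfl fun j _ => integral_mul_pderiv (hp j) hg hgc j

/-- A `C¹` cutoff function, equal to `1` on the ball of radius `r` and to `0` outside the ball of
radius `2 r`, obtained by scaling a fixed bump function. -/
def cutoff (n : ℕ) (r : ℝ) (x : Space n) : ℝ :=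
  (⟨1, 2, one_pos, one_lt_two⟩ : ContDiffBump (0 : Space n)) (r⁻¹ • x)

theorem contDiff_cutoff (r : ℝ) : ContDiff ℝ 1 (cutoff n r) :=
  (ContDiffBump.contDiff _).comp (contDiff_const_smul _)

theorem hasCompactSupport_cutoff {r : ℝ} (hr : r ≠ 0) : HasCompactSupport (cutoff n r) :=
  (ContDiffBump.hasCompactSupport _).comp_smul (inv_ne_zero hr)

theorem cutoff_nonneg (r : ℝ) (x : Space n) : 0 ≤ cutoff n r x :=
  ContDiffBump.nonneg _

theorem cutoff_eq_one {r : ℝ} {x : Space n} (hr : 0 < r) (hx : ‖x‖ ≤ r) : cutoff n r x = 1 := by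
  refine ContDiffBump.one_of_mem_closedBall _ ?_
  rw [mem_closedBall_zero_iff, norm_smul, norm_inv, Real.norm_of_nonneg hr.le]
  exact inv_mul_le_one_of_le₀ hx hr.le

theorem pderiv_comp_smul (f : Space n → ℝ) (c : ℝ) (j : Fin n) (x : Space n) :
    pderiv j (fun y => f (c • y)) x = c * pderiv j f (c • x) := by
  simp [pderiv, fderiv_comp_smul]

theorem abs_pderiv_le_norm_fderiv (f : Space n → ℝ) (x : Space n) (j : Fin n) :
    |pderiv j f x| ≤ ‖fderiv ℝ f x‖ := by
  simpa [pderiv] using (fderiv ℝ f x).le_opNorm (EuclideanSpace.single j (1 : ℝ))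

theorem cutoff_eq_cutoff_one_smul (r : ℝ) : cutoff n r = fun x => cutoff n 1 (r⁻¹ • x) := by
  ext x
  simp [cutoff]

theorem pderiv_cutoff_one_eq_zero {x : Space n} (hx : ‖x‖ < 1) (j : Fin n) :
    pderiv j (cutoff n 1) x = 0 := by
  have hconst : cutoff n 1 =ᶠ[𝓝 x] fun _ => 1 := by
    filter_upwards [continuous_norm.continuousAt.eventually_lt_const hx] with y hy
      using cutoff_eq_one one_pos hy.le
  rw [pderiv, hconst.fderiv_eq]
  simp

theorem integral_pderiv_cutoff_mul (f : Space n → ℝ) {r : ℝ} (hr : 0 < r) (j : Fin n) :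
    ∫ x, pderiv j (cutoff n r) x * f x
      = r ^ (n - 1) * ∫ x, pderiv j (cutoff n 1) x * f (r • x) := by
  have hscale := Measure.integral_comp_smul volume
    (fun x => pderiv j (cutoff n 1) (r⁻¹ • x) * f x) r
  simp only [inv_smul_smul₀ hr.ne', finrank_euclideanSpace_fin, smul_eq_mul,
    abs_of_pos (inv_pos.2 (pow_pos hr n))] at hscale
  rw [hscale, ← mul_assoc, cutoff_eq_cutoff_one_smul]
  simp only [pderiv_comp_smul (cutoff n 1), mul_assoc, integral_const_mul]
  rw [← mul_assoc, ← pow_sub_one_mul j.pos.ne' r]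
  congr 1
  field_simp

theorem tendsto_integral_pderiv_cutoff_mul {f : Space n → ℝ}
    (hf : f =o[cocompact (Space n)] fun x => 1 / ‖x‖ ^ (n - 1)) (j : Fin n) :
    Tendsto (fun r => ∫ x, pderiv j (cutoff n r) x * f x) atTop (𝓝 0) := by
  have hint : Integrable (pderiv j (cutoff n 1)) :=
    integrable_pderiv (contDiff_cutoff 1) (hasCompactSupport_cutoff one_ne_zero) j
  suffices hlittle : (fun r => ∫ x, pderiv j (cutoff n r) x * f x)
      =o[atTop] fun _ => ∫ x, ‖pderiv j (cutoff n 1) x‖ from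
    (isLittleO_one_iff ℝ).1 (hlittle.trans_isBigO (isBigO_const_one ℝ _ _))
  refine IsLittleO.of_bound fun ε hε => ?_
  have hbound := hf.def hε
  rw [← Metric.cobounded_eq_cocompact, ← comap_norm_atTop, eventually_comap] at hbound
  obtain ⟨r₀, hr₀⟩ := eventually_atTop.1 hbound
  filter_upwards [eventually_ge_atTop r₀, eventually_gt_atTop 0] with r hr hr_pos
  rw [integral_pderiv_cutoff_mul f hr_pos, ← integral_const_mul,
    Real.norm_of_nonneg (integral_nonneg fun x => norm_nonneg _), ← integral_const_mul]
  refine norm_integral_le_of_norm_le (hint.norm.const_mul ε) (Eventually.of_forall fun x => ?_)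
  rcases lt_or_ge ‖x‖ 1 with hx | hx
  · simp [pderiv_cutoff_one_eq_zero hx]
  have hnorm : ‖r • x‖ = r * ‖x‖ := by rw [norm_smul, Real.norm_of_nonneg hr_pos.le]
  have hfx : ‖f (r • x)‖ ≤ ε / r ^ (n - 1) := by
    refine (hr₀ ‖r • x‖ (hr.trans ?_) _ rfl).trans ?_
    · rw [hnorm]
      exact le_mul_of_one_le_right hr_pos.le hx
    · rw [Real.norm_of_nonneg (by positivity), mul_one_div, hnorm]
      gcongr
      exact le_mul_of_one_le_right hr_pos.le hx
  calc ‖r ^ (n - 1) * (pderiv j (cutoff n 1) x * f (r • x))‖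
      = r ^ (n - 1) * ‖pderiv j (cutoff n 1) x‖ * ‖f (r • x)‖ := by
        rw [norm_mul, norm_mul, Real.norm_of_nonneg (by positivity), mul_assoc]
    _ ≤ r ^ (n - 1) * ‖pderiv j (cutoff n 1) x‖ * (ε / r ^ (n - 1)) := by gcongr
    _ = ε * ‖pderiv j (cutoff n 1) x‖ := by field_simp

theorem tendsto_integral_cutoff_mul_laplacian {θ : Space n → ℝ} (hθ : ContDiff ℝ 2 θ)
    (hdecay : (fun x => gradient θ x) =o[cocompact (Space n)] fun x => 1 / ‖x‖ ^ (n - 1)) :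
    Tendsto (fun r => ∫ x, cutoff n r x * Laplacian.laplacian θ x) atTop (𝓝 0) := by
  have hpderiv : ∀ j, pderiv j θ =o[cocompact (Space n)] fun x => 1 / ‖x‖ ^ (n - 1) := fun j =>
    (isBigO_of_le _ fun x => (abs_pderiv_le_norm_fderiv θ x j).trans_eq
      (by simp [gradient])).trans_isLittleO hdecay
  have hsum : Tendsto (fun r => -∑ j, ∫ x, pderiv j (cutoff n r) x * pderiv j θ x) atTop (𝓝 0) := by
    simpa using (tendsto_finsetSum Finset.univ fun j _ =>
      tendsto_integral_pderiv_cutoff_mul (hpderiv j) j).neg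
  refine hsum.congr' ?_
  filter_upwards [eventually_ne_atTop 0] with r hr
  exact (integral_mul_laplacian hθ (contDiff_cutoff r) (hasCompactSupport_cutoff hr)).symm

theorem integral_laplacian_eq_zero {θ : Space n → ℝ} (hθ : ContDiff ℝ 2 θ)
    (hdecay : (fun x => gradient θ x) =o[cocompact (Space n)] fun x => 1 / ‖x‖ ^ (n - 1)) {a : ℝ}
    (h : ∀ x, a < ‖x‖ → Laplacian.laplacian θ x = 0) : ∫ x, Laplacian.laplacian θ x = 0 := by
  refine tendsto_nhds_unique (tendsto_const_nhds.congr' ?_)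
    (tendsto_integral_cutoff_mul_laplacian hθ hdecay)
  filter_upwards [eventually_ge_atTop a, eventually_gt_atTop 0] with r har hr
  refine integral_congr_ae (Eventually.of_forall fun x => ?_)
  rcases lt_or_ge a ‖x‖ with hx | hx
  · simp [h x hx]
  · simp [cutoff_eq_one hr (hx.trans har)]

end Laplacian

section HeatFlux

variable {n : ℕ} {θ q : Space n → ℝ}

theorem comp_eventuallyEq_comp_or_zero (hq : Continuous q) (h : ∀ x, 0 < q x → θ x = q x)
    {φ : ℝ → ℝ} {δ : ℝ} (hδ : 0 < δ) (hφ : ∀ y ≤ δ, φ y = 0) (x : Space n) :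
    φ ∘ q =ᶠ[𝓝 x] φ ∘ θ ∨ φ ∘ q =ᶠ[𝓝 x] 0 := by
  rcases lt_or_ge 0 (q x) with hx | hx
  · left
    filter_upwards [hq.continuousAt.eventually_const_lt hx] with y hy
    simp [h y hy]
  · right
    filter_upwards [hq.continuousAt.eventually_lt_const (hx.trans_lt hδ)] with y hy
    exact hφ _ hy.le

theorem integral_comp_mul_laplacian_nonpos (hθ : ContDiff ℝ 2 θ) (hq : Continuous q)
    (hqc : HasCompactSupport q) (h : ∀ x, 0 < q x → θ x = q x) {φ : ℝ → ℝ}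
    (hφ : ContDiff ℝ 1 φ) (hφ_mono : Monotone φ) {δ : ℝ} (hδ : 0 < δ) (hφ₀ : ∀ y ≤ δ, φ y = 0) :
    ∫ x, (φ ∘ q) x * Laplacian.laplacian θ x ≤ 0 := by
  have hlocal := comp_eventuallyEq_comp_or_zero hq h hδ hφ₀
  have hcomp : ContDiff ℝ 1 (φ ∘ q) := contDiff_iff_contDiffAt.2 fun x =>
    (hlocal x).elim (hφ.comp (hθ.of_le one_le_two)).contDiffAt.congr_of_eventuallyEq
      contDiffAt_const.congr_of_eventuallyEq
  rw [integral_mul_laplacian hθ hcomp (hqc.comp_left (hφ₀ 0 hδ.le)), neg_nonpos]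
  refine Finset.sum_nonneg fun j _ => integral_nonneg fun x => ?_
  rcases hlocal x with hx | hx
  · have hchain := (hφ.differentiable one_ne_zero (θ x)).hasDerivAt.comp_hasFDerivAt x
      (hθ.differentiable two_ne_zero x).hasFDerivAt
    have hpderiv : pderiv j (φ ∘ q) x = deriv φ (θ x) * pderiv j θ x := by
      rw [pderiv, hx.fderiv_eq, hchain.fderiv]
      rfl
    rw [hpderiv, mul_assoc]
    exact mul_nonneg hφ_mono.deriv_nonneg (mul_self_nonneg _)
  · simp [pderiv_eq_zero_of_eventuallyEq hx]

theorem tendsto_smoothTransition_mul_sub_one (y : ℝ) :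
    Tendsto (fun k : ℕ => Real.smoothTransition ((k + 1) * y - 1)) atTop
      (𝓝 (if 0 < y then 1 else 0)) := by
  split_ifs with hy
  · have hlarge : Tendsto (fun k : ℕ => ((k : ℝ) + 1) * y) atTop atTop :=
      (tendsto_atTop_add_const_right _ _ tendsto_natCast_atTop_atTop).atTop_mul_const hy
    refine tendsto_const_nhds.congr' ?_
    filter_upwards [hlarge.eventually_ge_atTop 2] with k hk
    exact (Real.smoothTransition.one_of_one_le (by linarith)).symm
  · refine tendsto_const_nhds.congr fun k => (Real.smoothTransition.zero_of_nonpos ?_).symm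
    nlinarith [mul_nonneg (by positivity : (0 : ℝ) ≤ k + 1) (neg_nonneg.2 (not_lt.1 hy))]

theorem integrableOn_laplacian_pos (hθ : ContDiff ℝ 2 θ) (hqc : HasCompactSupport q) :
    IntegrableOn (fun x => Laplacian.laplacian θ x) {x | 0 < q x} :=
  ((continuous_laplacian hθ).continuousOn.integrableOn_compact hqc).mono_set
    fun _ hx => subset_tsupport q (ne_of_gt hx)

/-- On the boundary of `{0 < q}` the function `q` vanishes, so the gradient of `θ` can only point
inwards. Testing with an approximation of the indicator function of `{0 < q}` by monotone functions
of `q` avoids any regularity assumption on that boundary. -/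
theorem setIntegral_pos_laplacian_nonpos (hθ : ContDiff ℝ 2 θ) (hq : Continuous q)
    (hqc : HasCompactSupport q) (h : ∀ x, 0 < q x → θ x = q x) :
    ∫ x in {x | 0 < q x}, Laplacian.laplacian θ x ≤ 0 := by
  have hG : MeasurableSet {x | 0 < q x} := (isOpen_lt continuous_const hq).measurableSet
  let φ : ℕ → ℝ → ℝ := fun k y => Real.smoothTransition ((k + 1) * y - 1)
  have hφ : ∀ k, ContDiff ℝ 1 (φ k) := fun k =>
    Real.smoothTransition.contDiff.comp ((contDiff_const.mul contDiff_id).sub contDiff_const)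
  have hφ_mono : ∀ k, Monotone (φ k) := fun k y z hyz =>
    Real.smoothTransition.monotone (by gcongr)
  have hφ₀ : ∀ k : ℕ, ∀ y ≤ ((k : ℝ) + 1)⁻¹, φ k y = 0 := fun k y hy =>
    Real.smoothTransition.zero_of_nonpos
      (sub_nonpos.2 ((mul_le_mul_of_nonneg_left hy (by positivity)).trans_eq
        (mul_inv_cancel₀ (by positivity))))
  have hlim : Tendsto (fun k => ∫ x, (φ k ∘ q) x * Laplacian.laplacian θ x) atTop
      (𝓝 (∫ x, {x | 0 < q x}.indicator (fun x => Laplacian.laplacian θ x) x)) := by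
    refine tendsto_integral_of_dominated_convergence
      ({x | 0 < q x}.indicator fun x => ‖Laplacian.laplacian θ x‖)
      (fun k => (((hφ k).continuous.comp hq).mul
        (continuous_laplacian hθ)).aestronglyMeasurable)
      ((integrable_indicator_iff hG).2 (integrableOn_laplacian_pos hθ hqc).norm)
      (fun k => Eventually.of_forall fun x => ?_) (Eventually.of_forall fun x => ?_)
    · rw [norm_mul, Real.norm_of_nonneg (show 0 ≤ (φ k ∘ q) x from Real.smoothTransition.nonneg _)]
      rcases lt_or_ge 0 (q x) with hx | hx
      · rw [indicator_of_mem (by exact hx)]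
        exact mul_le_of_le_one_left (norm_nonneg _) (Real.smoothTransition.le_one _)
      · rw [indicator_of_notMem (by exact hx.not_gt), Function.comp_apply,
          hφ₀ k _ (hx.trans (by positivity)), zero_mul]
    · have hindicator : {x | 0 < q x}.indicator (fun x => Laplacian.laplacian θ x) x
          = (if 0 < q x then 1 else 0) * Laplacian.laplacian θ x := by
        simp [indicator_apply]
      rw [hindicator]
      exact (tendsto_smoothTransition_mul_sub_one (q x)).mul_const _
  rw [← integral_indicator hG]
  exact le_of_tendsto' hlim fun k => integral_comp_mul_laplacian_nonpos hθ hq hqc h (hφ k)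
    (hφ_mono k) (by positivity) (hφ₀ k)

theorem setIntegral_closedBall_laplacian_nonneg (hθ : ContDiff ℝ 2 θ)
    (hdecay : (fun x => gradient θ x) =o[cocompact (Space n)] fun x => 1 / ‖x‖ ^ (n - 1)) {a : ℝ}
    (h : ∀ x, a < ‖x‖ → Laplacian.laplacian θ x ≤ 0) :
    0 ≤ ∫ x in Metric.closedBall 0 a, Laplacian.laplacian θ x := by
  have hΔ := continuous_laplacian hθ
  refine le_of_tendsto (tendsto_integral_cutoff_mul_laplacian hθ hdecay) ?_
  filter_upwards [eventually_ge_atTop a, eventually_gt_atTop 0] with r har hr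
  rw [← integral_indicator measurableSet_closedBall]
  refine integral_mono (((contDiff_cutoff r).continuous.mul hΔ).integrable_of_hasCompactSupport
      (hasCompactSupport_cutoff hr.ne').mul_right)
    ((integrable_indicator_iff measurableSet_closedBall).2
      (hΔ.continuousOn.integrableOn_compact (isCompact_closedBall 0 a))) fun x => ?_
  rcases le_or_gt ‖x‖ a with hx | hx
  · simp [hx, cutoff_eq_one hr (hx.trans har)]
  · simpa [hx.not_ge] using mul_nonpos_of_nonneg_of_nonpos (cutoff_nonneg r x) (h x hx)

theorem eq_zero_of_mem_interior_of_setIntegral_nonneg {f : Space n → ℝ} (hf : Continuous f)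
    {S : Set (Space n)} (hS : MeasurableSet S) (hfS : IntegrableOn f S) (hneg : ∀ y ∈ S, f y ≤ 0)
    (hint : 0 ≤ ∫ y in S, f y) {x : Space n} (hx : x ∈ interior S) : f x = 0 := by
  have hae : (fun y => -f y) =ᵐ[volume.restrict S] 0 := by
    refine (setIntegral_eq_zero_iff_of_nonneg_ae ?_ hfS.neg).1 ?_
    · filter_upwards [ae_restrict_mem hS] with y hy using neg_nonneg.2 (hneg y hy)
    · rw [integral_neg', neg_eq_zero]
      exact le_antisymm (setIntegral_nonpos hS hneg) hint
  have hzero := Measure.eqOn_open_of_ae_eq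
    (ae_restrict_of_ae_restrict_of_subset interior_subset hae) isOpen_interior
    hf.neg.continuousOn continuousOn_const hx
  simpa using hzero

theorem laplacian_eq_zero_of_notMem_tsupport (hθ : ContDiff ℝ 2 θ)
    (hdecay : (fun x => gradient θ x) =o[cocompact (Space n)] fun x => 1 / ‖x‖ ^ (n - 1))
    (hq : Continuous q) (hqc : HasCompactSupport q) (h : ∀ x, 0 < q x → θ x = q x)
    (hΔ : ∀ x, q x ≤ 0 → Laplacian.laplacian θ x ≤ 0) {x : Space n} (hx : x ∉ tsupport q) :
    Laplacian.laplacian θ x = 0 := by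
  obtain ⟨b, hb⟩ := hqc.isBounded.subset_closedBall 0
  set a := max b (‖x‖ + 1)
  set G := {x | 0 < q x}
  have hG : MeasurableSet G := (isOpen_lt continuous_const hq).measurableSet
  have hGa : G ⊆ Metric.closedBall 0 a := fun y hy =>
    Metric.closedBall_subset_closedBall (le_max_left _ _) (hb (subset_tsupport q (ne_of_gt hy)))
  have hout : ∀ y, a < ‖y‖ → q y ≤ 0 := fun y hy => not_lt.1 fun hqy =>
    hy.not_ge (mem_closedBall_zero_iff.1 (hGa hqy))
  have hint : IntegrableOn (fun y => Laplacian.laplacian θ y) (Metric.closedBall 0 a) :=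
    (continuous_laplacian hθ).continuousOn.integrableOn_compact (isCompact_closedBall 0 a)
  refine eq_zero_of_mem_interior_of_setIntegral_nonneg (continuous_laplacian hθ)
    (measurableSet_closedBall.diff hG) (hint.mono_set sdiff_subset)
    (fun y hy => hΔ y (not_lt.1 hy.2)) ?_ (mem_interior.2
      ⟨Metric.ball 0 a ∩ (tsupport q)ᶜ, fun y hy => ⟨Metric.ball_subset_closedBall hy.1,
        fun hyG => hy.2 (subset_tsupport q (ne_of_gt hyG))⟩,
        Metric.isOpen_ball.inter (isClosed_tsupport q).isOpen_compl,
        mem_ball_zero_iff.2 ((lt_add_one _).trans_le (le_max_right _ _)), hx⟩)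
  rw [setIntegral_sdiff hG hint hGa, sub_nonneg]
  exact (setIntegral_pos_laplacian_nonpos hθ hq hqc h).trans
    (setIntegral_closedBall_laplacian_nonneg hθ hdecay fun y hy => hΔ y (hout y hy))

end HeatFlux

section Vacuum

variable {n : ℕ} {R γ μ lam K T t : ℝ} {ρ : ℝ → Space n → ℝ} {u : ℝ → Space n → Space n}
  {s θ : ℝ → Space n → ℝ} {x : Space n}

theorem pressure_eq_zero_of_density_eq_zero (h : ρ t x = 0) : pressure R ρ θ t x = 0 := by
  simp [pressure, h]

theorem energyDensity_eq_zero_of_density_eq_zero (h : ρ t x = 0) :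
    energyDensity R γ ρ u θ t x = 0 := by
  simp [energyDensity, h]

theorem energyDensity_eq (R γ : ℝ) (ρ : ℝ → Space n → ℝ) (u : ℝ → Space n → Space n)
    (θ : ℝ → Space n → ℝ) (t : ℝ) (x : Space n) :
    energyDensity R γ ρ u θ t x = 1 / 2 * ρ t x * ‖u t x‖ ^ 2 + pressure R ρ θ t x / (γ - 1) := by
  simp only [energyDensity, pressure, specificHeat]
  ring

theorem deriv_eq_zero_of_nonneg {f : ℝ → ℝ} (hf : ∀ t ∈ Icc 0 T, 0 ≤ f t) (ht : t ∈ Ioo 0 T)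
    (h : f t = 0) : deriv f t = 0 :=
  IsLocalMin.deriv_eq_zero <| by
    filter_upwards [Icc_mem_nhds ht.1 ht.2] with τ hτ using h.trans_le (hf τ hτ)

namespace IsClassicalSolution

theorem isC1OnSlab_pressure (h : IsClassicalSolution R γ μ lam K T ρ u s θ)
    (hγ : 1 < γ) : IsC1OnSlab T (pressure R ρ θ) := by
  have hstate : ContDiffOn ℝ 1 (fun q : ℝ × Space n =>
      Real.exp (s q.1 q.2 / specificHeat R γ) * ρ q.1 q.2 ^ γ) (Icc 0 T ×ˢ univ) :=
    (h.contDiff_entropy.div_const _).exp.mul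
      ((Real.contDiff_rpow_const_of_le (n := 1) (by exact_mod_cast hγ.le)).comp_contDiffOn
        h.contDiff_density)
  exact hstate.congr fun q hq => h.state q.1 hq.1 q.2

theorem isC1OnSlab_energyDensity (h : IsClassicalSolution R γ μ lam K T ρ u s θ)
    (hγ : 1 < γ) : IsC1OnSlab T (energyDensity R γ ρ u θ) := by
  have hsum : ContDiffOn ℝ 1 (fun q : ℝ × Space n =>
      1 / 2 * ρ q.1 q.2 * ‖u q.1 q.2‖ ^ 2 + pressure R ρ θ q.1 q.2 / (γ - 1)) (Icc 0 T ×ˢ univ) :=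
    ((contDiffOn_const.mul h.contDiff_density).mul (h.contDiff_velocity.norm_sq ℝ)).add
      ((h.isC1OnSlab_pressure hγ).div_const _)
  exact hsum.congr fun q _ => energyDensity_eq R γ ρ u θ q.1 q.2

theorem pressure_nonneg (h : IsClassicalSolution R γ μ lam K T ρ u s θ)
    (ht : t ∈ Icc 0 T) (x : Space n) : 0 ≤ pressure R ρ θ t x := by
  rw [h.state t ht x]
  exact mul_nonneg (Real.exp_pos _).le (Real.rpow_nonneg (h.density_nonneg t ht x) _)

theorem energyDensity_nonneg (h : IsClassicalSolution R γ μ lam K T ρ u s θ)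
    (hγ : 1 < γ) (ht : t ∈ Icc 0 T) (x : Space n) :
    0 ≤ energyDensity R γ ρ u θ t x := by
  rw [energyDensity_eq]
  exact add_nonneg (mul_nonneg (mul_nonneg one_half_pos.le (h.density_nonneg t ht x)) (sq_nonneg _))
    (div_nonneg (h.pressure_nonneg ht x) (sub_pos.2 hγ).le)

theorem sum_pderiv_stress_eq_zero (h : IsClassicalSolution R γ μ lam K T ρ u s θ)
    (ht : t ∈ Ioo 0 T) (hx : ρ t x = 0) (i : Fin n) :
    ∑ j, pderiv j (stress μ lam (u t) i j) x = 0 := by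
  have ht' := Ioo_subset_Icc_self ht
  have hρ : IsC1OnSlab T ρ := h.contDiff_density
  have hu : IsC1OnSlab T u := h.contDiff_velocity
  have hρx := (hρ.contDiff ht').differentiable one_ne_zero x
  have hux := fun i => ((hu.coord i).contDiff ht').differentiable one_ne_zero x
  have htime : deriv (fun τ => ρ τ x * u τ x i) t = 0 := by
    rw [deriv_fun_mul (hρ.differentiableAt_time ht x) ((hu.coord i).differentiableAt_time ht x),
      deriv_eq_zero_of_nonneg (fun τ hτ => h.density_nonneg τ hτ x) ht hx, hx]
    simp
  have hconv : ∀ j, pderiv j (fun y => ρ t y * u t y i * u t y j) x = 0 := fun j => by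
    rw [pderiv_mul (hρx.fun_mul (hux i)) (hux j), pderiv_mul hρx (hux i),
      pderiv_eq_zero_of_nonneg (h.density_nonneg t ht') hx, hx]
    simp
  have hpressure : pderiv i (pressure R ρ θ t) x = 0 :=
    pderiv_eq_zero_of_nonneg (h.pressure_nonneg ht') (pressure_eq_zero_of_density_eq_zero hx) i
  simp [← h.momentum t ht x i, htime, hconv, hpressure]

theorem dissipation_add_laplacian_eq_zero (h : IsClassicalSolution R γ μ lam K T ρ u s θ)
    (hγ : 1 < γ) (ht : t ∈ Ioo 0 T) (hx : ρ t x = 0) :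
    dissipation μ lam (u t) x + K * Laplacian.laplacian (θ t) x = 0 := by
  have ht' := Ioo_subset_Icc_self ht
  have hu : IsC1OnSlab T u := h.contDiff_velocity
  have hux := (hu.contDiff ht').differentiable one_ne_zero x
  have htime : deriv (fun τ => energyDensity R γ ρ u θ τ x) t = 0 :=
    deriv_eq_zero_of_nonneg (fun τ hτ => h.energyDensity_nonneg hγ hτ x) ht
      (energyDensity_eq_zero_of_density_eq_zero hx)
  set g := fun y => energyDensity R γ ρ u θ t y + pressure R ρ θ t y
  have hg : ∀ y, 0 ≤ g y := fun y =>
    add_nonneg (h.energyDensity_nonneg hγ ht' y) (h.pressure_nonneg ht' y)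
  have hgx : g x = 0 := by
    simp only [g, energyDensity_eq_zero_of_density_eq_zero hx,
      pressure_eq_zero_of_density_eq_zero hx, add_zero]
  have hgd : DifferentiableAt ℝ g x := (((h.isC1OnSlab_energyDensity hγ).add
    (h.isC1OnSlab_pressure hγ)).contDiff ht').differentiable one_ne_zero x
  have hflux : divergence (fun y => g y • u t y) x = 0 := by
    rw [divergence_smul hgd hux, hgx, fderiv_apply_eq_sum_pderiv]
    simp [pderiv_eq_zero_of_nonneg hg hgx]
  have hbalance := h.energy t ht x
  rw [htime, hflux, divergence_stress_velocity (h.contDiff_two_velocity t ht')] at hbalance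
  simp only [h.sum_pderiv_stress_eq_zero ht hx, mul_zero, Finset.sum_const_zero] at hbalance
  linarith

end IsClassicalSolution

/-- The temperature `exp (s / c_ν) ρ ^ (γ - 1) / R` given by the state equation away from vacuum,
extended by zero. -/
def stateTemperature (R γ : ℝ) (ρ s : ℝ → Space n → ℝ) (t : ℝ) (x : Space n) : ℝ :=
  Real.exp (s t x / specificHeat R γ) * ρ t x ^ (γ - 1) / R

namespace IsClassicalSolution

theorem continuous_stateTemperature (h : IsClassicalSolution R γ μ lam K T ρ u s θ)
    (hγ : 1 < γ) (ht : t ∈ Icc 0 T) :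
    Continuous (stateTemperature R γ ρ s t) := by
  have hs : Continuous (s t) := (IsC1OnSlab.contDiff h.contDiff_entropy ht).continuous
  have hρ : Continuous fun x => ρ t x ^ (γ - 1) :=
    (IsC1OnSlab.contDiff h.contDiff_density ht).continuous.rpow_const
      fun x => Or.inr (sub_nonneg.2 hγ.le)
  exact ((Real.continuous_exp.comp (hs.div_const _)).mul hρ).div_const R

theorem stateTemperature_pos_iff (h : IsClassicalSolution R γ μ lam K T ρ u s θ)
    (hR : 0 < R) (hγ : 1 < γ) (ht : t ∈ Icc 0 T) :
    0 < stateTemperature R γ ρ s t x ↔ ρ t x ≠ 0 := by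
  refine ⟨fun hpos hx => ?_, fun hx => ?_⟩
  · simp [stateTemperature, hx, Real.zero_rpow (sub_pos.2 hγ).ne'] at hpos
  · have hρ := (h.density_nonneg t ht x).lt_of_ne' hx
    exact div_pos (mul_pos (Real.exp_pos _) (Real.rpow_pos_of_pos hρ _)) hR

theorem temperature_eq_stateTemperature (h : IsClassicalSolution R γ μ lam K T ρ u s θ)
    (hR : 0 < R) (ht : t ∈ Icc 0 T) (hx : ρ t x ≠ 0) :
    θ t x = stateTemperature R γ ρ s t x := by
  have hstate := h.state t ht x
  rw [pressure] at hstate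
  rw [stateTemperature, Real.rpow_sub_one hx, eq_div_iff hR.ne']
  field_simp
  linear_combination hstate

theorem laplacian_eq_zero_of_norm_gt (h : IsClassicalSolution R γ μ lam K T ρ u s θ)
    (hR : 0 < R) (hγ : 1 < γ) (hμ : 0 < μ) (hlam : 0 < 2 * μ + n * lam) (hK : 0 < K)
    (hdecay : TemperatureGradientDecay T θ) (ht : t ∈ Ioo 0 T) {r : ℝ}
    (hvac : ∀ x, r < ‖x‖ → ρ t x = 0) (hx : r < ‖x‖) : Laplacian.laplacian (θ t) x = 0 := by
  have ht' := Ioo_subset_Icc_self ht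
  have hpos := fun x => h.stateTemperature_pos_iff hR hγ ht' (x := x)
  have hsupp : tsupport (stateTemperature R γ ρ s t) ⊆ Metric.closedBall 0 r := by
    refine closure_minimal (fun y hy => ?_) Metric.isClosed_closedBall
    by_contra hyr
    have hρ := hvac y (not_le.1 fun hle => hyr (mem_closedBall_zero_iff.2 hle))
    exact hy (by simp [stateTemperature, hρ, Real.zero_rpow (sub_pos.2 hγ).ne'])
  refine laplacian_eq_zero_of_notMem_tsupport
    (h.contDiff_two_temperature hK.ne' t ⟨ht.1, ht.2.le⟩) (hdecay t ⟨ht.1, ht.2.le⟩)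
    (h.continuous_stateTemperature hγ ht')
    ((isCompact_closedBall 0 r).of_isClosed_subset (isClosed_tsupport _) hsupp)
    (fun y hy => h.temperature_eq_stateTemperature hR ht' ((hpos y).1 hy)) (fun y hy => ?_)
    fun hmem => hx.not_ge (mem_closedBall_zero_iff.1 (hsupp hmem))
  have hρ : ρ t y = 0 := not_not.1 fun hne => hy.not_gt ((hpos y).2 hne)
  have hbalance := h.dissipation_add_laplacian_eq_zero hγ ht hρ
  have hdiss := dissipation_nonneg hμ hlam (u t) y
  exact nonpos_of_mul_nonpos_right (by linarith) hK

theorem dissipation_eq_zero_of_norm_gt (h : IsClassicalSolution R γ μ lam K T ρ u s θ)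
    (hR : 0 < R) (hγ : 1 < γ) (hμ : 0 < μ) (hlam : 0 < 2 * μ + n * lam) (hK : 0 ≤ K)
    (hdecay : K ≠ 0 → TemperatureGradientDecay T θ) (ht : t ∈ Ioo 0 T) {r : ℝ}
    (hvac : ∀ x, r < ‖x‖ → ρ t x = 0) (hx : r < ‖x‖) : dissipation μ lam (u t) x = 0 := by
  have hbalance := h.dissipation_add_laplacian_eq_zero hγ ht (hvac x hx)
  rcases hK.eq_or_lt with rfl | hK
  · simpa using hbalance
  · simpa [h.laplacian_eq_zero_of_norm_gt hR hγ hμ hlam hK (hdecay hK.ne') ht hvac hx]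
      using hbalance

theorem velocity_eq_zero_of_norm_gt (h : IsClassicalSolution R γ μ lam K T ρ u s θ)
    (hR : 0 < R) (hγ : 1 < γ) (hμ : 0 < μ)
    (hlam : 0 < 2 * μ + n * lam) (hK : 0 ≤ K) (hdecay : K ≠ 0 → TemperatureGradientDecay T θ)
    {p : ENNReal} (hp₀ : p ≠ 0) (hp : p ≠ ⊤) (ht : t ∈ Ioo 0 T) (hup : MemLp (u t) p) {r : ℝ}
    (hr : 0 ≤ r) (hvac : ∀ x, r < ‖x‖ → ρ t x = 0) (hx : r < ‖x‖) : u t x = 0 :=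
  eq_zero_of_deformation_eq_zero_of_memLp (h.contDiff_two_velocity t (Ioo_subset_Icc_self ht))
    hp₀ hp hup hr (fun _ hy i j => deformation_eq_zero_of_dissipation_eq_zero hμ hlam
      (h.dissipation_eq_zero_of_norm_gt hR hγ hμ hlam hK hdecay ht hvac hy) i j) hx

end IsClassicalSolution

end Vacuum

section SlabIntegral

variable {V E : Type*} [NormedAddCommGroup V]

theorem hasCompactSupport_of_norm_gt [ProperSpace V] [Zero E] {f : V → E} {r : ℝ}
    (hf : ∀ x, r < ‖x‖ → f x = 0) : HasCompactSupport f :=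
  HasCompactSupport.intro (isCompact_closedBall 0 r) fun x hx =>
    hf x (not_le.1 fun hle => hx (mem_closedBall_zero_iff.2 hle))

theorem eventuallyEq_zero_of_norm_gt [Zero E] {f : V → E} {r : ℝ} (hf : ∀ x, r < ‖x‖ → f x = 0)
    {x : V} (hx : r < ‖x‖) : f =ᶠ[𝓝 x] 0 := by
  filter_upwards [continuous_norm.continuousAt.eventually_const_lt hx] with y hy using hf y hy

variable [NormedSpace ℝ V] [ProperSpace V] [MeasurableSpace V] [BorelSpace V]
  [NormedAddCommGroup E] [NormedSpace ℝ E] {T r t : ℝ} {f : ℝ → V → E} (ν : Measure V)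
  [IsFiniteMeasureOnCompacts ν]

namespace IsC1OnSlab

theorem integrable (hf : IsC1OnSlab T f) (ht : t ∈ Icc 0 T) (hfr : ∀ x, r < ‖x‖ → f t x = 0) :
    Integrable (f t) ν :=
  (hf.contDiff ht).continuous.integrable_of_hasCompactSupport (hasCompactSupport_of_norm_gt hfr)

theorem continuousOn_integral (hf : IsC1OnSlab T f)
    (hfr : ∀ t ∈ Icc 0 T, ∀ x, r < ‖x‖ → f t x = 0) :
    ContinuousOn (fun t => ∫ x, f t x ∂ν) (Icc 0 T) :=
  continuousOn_integral_of_compact_support (isCompact_closedBall (0 : V) r)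
    (ContDiffOn.continuousOn hf) fun t x ht hx => hfr t ht x (by simpa using hx)

theorem hasDerivAt_integral [CompleteSpace E] (hf : IsC1OnSlab T f)
    (hfr : ∀ t ∈ Icc 0 T, ∀ x, r < ‖x‖ → f t x = 0) (ht : t ∈ Ioo 0 T) :
    HasDerivAt (fun t => ∫ x, f t x ∂ν) (∫ x, deriv (fun τ => f τ x) t ∂ν) t := by
  have hnhds : Icc 0 T ∈ 𝓝 t := Icc_mem_nhds ht.1 ht.2
  obtain ⟨L, hL⟩ := hf.exists_lipschitzOnWith_uncurry 0 r
  refine (hasDerivAt_integral_of_dominated_loc_of_lip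
    (bound := (Metric.closedBall (0 : V) r).indicator fun _ => (L : ℝ)) hnhds ?_
    (hf.integrable ν (Ioo_subset_Icc_self ht) (hfr t (Ioo_subset_Icc_self ht)))
    (hf.continuous_deriv_time ht).aestronglyMeasurable ?_ ?_
    (Eventually.of_forall fun x => (hf.differentiableAt_time ht x).hasDerivAt)).2
  · filter_upwards [hnhds] with τ hτ using (hf.contDiff hτ).continuous.aestronglyMeasurable
  · refine Eventually.of_forall fun x => LipschitzOnWith.of_dist_le_mul fun a ha b hb => ?_
    by_cases hx : x ∈ Metric.closedBall (0 : V) r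
    · simpa [indicator_of_mem hx, Prod.dist_eq] using hL.dist_le_mul (a, x) ⟨ha, hx⟩ (b, x) ⟨hb, hx⟩
    · have hx' : r < ‖x‖ := by simpa using hx
      simp [indicator_of_notMem hx, hfr a ha x hx', hfr b hb x hx']
  · exact (integrable_indicator_iff measurableSet_closedBall).2
      (integrableOn_const measure_closedBall_lt_top.ne)

end IsC1OnSlab

theorem eq_of_hasDerivAt_zero {g : ℝ → ℝ} (hg : ContinuousOn g (Icc 0 T))
    (hg' : ∀ t ∈ Ioo 0 T, HasDerivAt g 0 t) (ht : t ∈ Icc 0 T) : g t = g 0 := by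
  rcases ht.1.eq_or_lt with rfl | hpos
  · rfl
  obtain ⟨c, -, hslope⟩ := exists_hasDerivAt_eq_slope g (fun _ => 0) hpos
    (hg.mono (Icc_subset_Icc_right ht.2)) fun τ hτ => hg' τ ⟨hτ.1, hτ.2.trans_le ht.2⟩
  simpa [hpos.ne', sub_eq_zero] using hslope.symm

end SlabIntegral

section ConservationLaws

variable {n : ℕ} {R γ μ lam K T r t : ℝ} {ρ : ℝ → Space n → ℝ} {u : ℝ → Space n → Space n}
  {s θ : ℝ → Space n → ℝ} {x : Space n}

/-- The momentum flux tensor `ρ uᵢ uⱼ + p δᵢⱼ - 𝒯ᵢⱼ`. -/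
def momentumFlux (R μ lam : ℝ) (ρ : ℝ → Space n → ℝ) (u : ℝ → Space n → Space n)
    (θ : ℝ → Space n → ℝ) (t : ℝ) (i j : Fin n) (x : Space n) : ℝ :=
  ρ t x * u t x i * u t x j + (if i = j then pressure R ρ θ t x else 0)
    - stress μ lam (u t) i j x

/-- The convective and viscous part `(½ ρ |u|² + ρ e + p) uⱼ - ∑ᵢ uᵢ 𝒯ᵢⱼ` of the energy flux. -/
def energyFlux (R γ μ lam : ℝ) (ρ : ℝ → Space n → ℝ) (u : ℝ → Space n → Space n)
    (θ : ℝ → Space n → ℝ) (t : ℝ) (j : Fin n) (x : Space n) : ℝ :=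
  (energyDensity R γ ρ u θ t x + pressure R ρ θ t x) * u t x j
    - ∑ i, u t x i * stress μ lam (u t) i j x

/-- The radial momentum `∫ ρ x · u dx`, half the time derivative of the moment of inertia. -/
def radialMomentum (ρ : ℝ → Space n → ℝ) (u : ℝ → Space n → Space n) (t : ℝ) : ℝ :=
  ∫ x, ρ t x * ⟪x, u t x⟫_ℝ

theorem sum_momentumFlux_diag (R μ lam : ℝ) (ρ : ℝ → Space n → ℝ) (u : ℝ → Space n → Space n)
    (θ : ℝ → Space n → ℝ) (t : ℝ) (x : Space n) :
    ∑ i, momentumFlux R μ lam ρ u θ t i i x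
      = ρ t x * ‖u t x‖ ^ 2 + n * pressure R ρ θ t x
        - (2 * μ + n * lam) * divergence (u t) x := by
  simp only [momentumFlux, if_true, Finset.sum_sub_distrib, Finset.sum_add_distrib,
    sum_stress_diag, Finset.sum_const, Finset.card_univ, Fintype.card_fin, nsmul_eq_mul,
    EuclideanSpace.real_norm_sq_eq, Finset.mul_sum]
  simp only [mul_assoc, sq]

theorem momentumFlux_eq_zero_of_norm_gt (hρ : ∀ x, r < ‖x‖ → ρ t x = 0)
    (hu : ∀ x, r < ‖x‖ → u t x = 0) (hx : r < ‖x‖) (i j : Fin n) :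
    momentumFlux R μ lam ρ u θ t i j x = 0 := by
  simp [momentumFlux, hρ x hx, pressure_eq_zero_of_density_eq_zero (hρ x hx),
    stress_eq_zero_of_eventuallyEq (eventuallyEq_zero_of_norm_gt hu hx)]

theorem energyFlux_eq_zero_of_velocity_eq_zero (hu : u t x = 0) (j : Fin n) :
    energyFlux R γ μ lam ρ u θ t j x = 0 := by
  simp [energyFlux, hu]

namespace IsClassicalSolution

theorem contDiff_momentumFlux (h : IsClassicalSolution R γ μ lam K T ρ u s θ) (hγ : 1 < γ)
    (ht : t ∈ Icc 0 T) (i j : Fin n) : ContDiff ℝ 1 (momentumFlux R μ lam ρ u θ t i j) := by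
  have hρ : IsC1OnSlab T ρ := h.contDiff_density
  have hu : IsC1OnSlab T u := h.contDiff_velocity
  have hp : ContDiff ℝ 1 fun x => if i = j then pressure R ρ θ t x else 0 := by
    split_ifs
    · exact (h.isC1OnSlab_pressure hγ).contDiff ht
    · exact contDiff_const
  exact ((((hρ.mul (hu.coord i)).mul (hu.coord j)).contDiff ht).add hp).sub
    (contDiff_stress (h.contDiff_two_velocity t ht) μ lam i j)

theorem contDiff_energyFlux (h : IsClassicalSolution R γ μ lam K T ρ u s θ) (hγ : 1 < γ)
    (ht : t ∈ Icc 0 T) (j : Fin n) : ContDiff ℝ 1 (energyFlux R γ μ lam ρ u θ t j) := by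
  have hu : IsC1OnSlab T u := h.contDiff_velocity
  exact (((((h.isC1OnSlab_energyDensity hγ).add (h.isC1OnSlab_pressure hγ)).mul
    (hu.coord j))).contDiff ht).sub <| ContDiff.sum fun i _ =>
      ((hu.coord i).contDiff ht).mul (contDiff_stress (h.contDiff_two_velocity t ht) μ lam i j)

theorem deriv_momentum (h : IsClassicalSolution R γ μ lam K T ρ u s θ) (hγ : 1 < γ)
    (ht : t ∈ Ioo 0 T) (x : Space n) (i : Fin n) :
    deriv (fun τ => ρ τ x * u τ x i) t
      = -∑ j, pderiv j (momentumFlux R μ lam ρ u θ t i j) x := by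
  have ht' := Ioo_subset_Icc_self ht
  have hρ : IsC1OnSlab T ρ := h.contDiff_density
  have hu : IsC1OnSlab T u := h.contDiff_velocity
  have hconv : ∀ j, DifferentiableAt ℝ (fun y => ρ t y * u t y i * u t y j) x := fun j =>
    (((hρ.mul (hu.coord i)).mul (hu.coord j)).contDiff ht').differentiable one_ne_zero x
  have hp : ∀ j, DifferentiableAt ℝ (fun y => if i = j then pressure R ρ θ t y else 0) x ∧
      pderiv j (fun y => if i = j then pressure R ρ θ t y else 0) x
        = if i = j then pderiv j (pressure R ρ θ t) x else 0 := fun j => by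
    split_ifs
    · exact ⟨((h.isC1OnSlab_pressure hγ).contDiff ht').differentiable one_ne_zero x, rfl⟩
    · simp [pderiv]
  have hflux : ∀ j, pderiv j (momentumFlux R μ lam ρ u θ t i j) x
      = pderiv j (fun y => ρ t y * u t y i * u t y j) x
        + (if i = j then pderiv j (pressure R ρ θ t) x else 0)
        - pderiv j (stress μ lam (u t) i j) x := fun j => by
    rw [← (hp j).2, ← pderiv_add (hconv j) (hp j).1, ← pderiv_sub ((hconv j).fun_add (hp j).1)
      ((contDiff_stress (h.contDiff_two_velocity t ht') μ lam i j).differentiable one_ne_zero x)]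
    rfl
  simp only [hflux, Finset.sum_sub_distrib, Finset.sum_add_distrib, Finset.sum_ite_eq,
    Finset.mem_univ, if_true, ← h.momentum t ht x i]
  ring

theorem deriv_energyDensity (h : IsClassicalSolution R γ μ lam K T ρ u s θ) (hγ : 1 < γ)
    (ht : t ∈ Ioo 0 T) (x : Space n) :
    deriv (fun τ => energyDensity R γ ρ u θ τ x) t
      = K * Laplacian.laplacian (θ t) x - ∑ j, pderiv j (energyFlux R γ μ lam ρ u θ t j) x := by
  have ht' := Ioo_subset_Icc_self ht
  have hu : IsC1OnSlab T u := h.contDiff_velocity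
  have hconv : ∀ j, DifferentiableAt ℝ
      (fun y => (energyDensity R γ ρ u θ t y + pressure R ρ θ t y) * u t y j) x := fun j =>
    ((((h.isC1OnSlab_energyDensity hγ).add (h.isC1OnSlab_pressure hγ)).mul
      (hu.coord j)).contDiff ht').differentiable one_ne_zero x
  have hwork : ∀ j, DifferentiableAt ℝ (fun y => ∑ i, u t y i * stress μ lam (u t) i j y) x :=
    fun j => (ContDiff.sum fun i _ => ((hu.coord i).contDiff ht').mul (contDiff_stress
      (h.contDiff_two_velocity t ht') μ lam i j)).differentiable one_ne_zero x
  have hflux : ∀ j, pderiv j (energyFlux R γ μ lam ρ u θ t j) x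
      = pderiv j (fun y => (energyDensity R γ ρ u θ t y + pressure R ρ θ t y) * u t y j) x
        - pderiv j (fun y => ∑ i, u t y i * stress μ lam (u t) i j y) x := fun j =>
    pderiv_sub (hconv j) (hwork j) j
  have hbalance := h.energy t ht x
  simp only [divergence, PiLp.smul_apply, smul_eq_mul] at hbalance
  simp only [hflux, Finset.sum_sub_distrib]
  linarith

theorem integral_density_eq (h : IsClassicalSolution R γ μ lam K T ρ u s θ)
    (hρ : ∀ t ∈ Icc 0 T, ∀ x, r < ‖x‖ → ρ t x = 0) (ht : t ∈ Icc 0 T) :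
    ∫ x, ρ t x = ∫ x, ρ 0 x := by
  have hslab : IsC1OnSlab T ρ := h.contDiff_density
  have hflux := fun j => hslab.mul (IsC1OnSlab.coord h.contDiff_velocity j)
  refine eq_of_hasDerivAt_zero (hslab.continuousOn_integral volume hρ) (fun t ht => ?_) ht
  have ht' := Ioo_subset_Icc_self ht
  refine (hslab.hasDerivAt_integral volume hρ ht).congr_deriv ?_
  simp only [fun x => eq_neg_of_add_eq_zero_left (h.mass t ht x)]
  rw [integral_neg, neg_eq_zero]
  exact integral_sum_pderiv_eq_zero (fun j => (hflux j).contDiff ht') fun j =>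
    hasCompactSupport_of_norm_gt (r := r) fun x hx => by simp [hρ t ht' x hx]

theorem laplacian_eq_zero_of_velocity_eventuallyEq
    (h : IsClassicalSolution R γ μ lam K T ρ u s θ) (hγ : 1 < γ) (hK : K ≠ 0) (ht : t ∈ Ioo 0 T)
    (hρ : ρ t x = 0) (hu : u t =ᶠ[𝓝 x] 0) : Laplacian.laplacian (θ t) x = 0 := by
  have hbalance := h.dissipation_add_laplacian_eq_zero hγ ht hρ
  simpa [dissipation, stress_eq_zero_of_eventuallyEq hu, hK] using hbalance

theorem integrable_mul_laplacian (h : IsClassicalSolution R γ μ lam K T ρ u s θ) (hγ : 1 < γ)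
    (ht : t ∈ Ioo 0 T) (hρ : ∀ x, r < ‖x‖ → ρ t x = 0) (hu : ∀ x, r < ‖x‖ → u t x = 0) :
    Integrable fun x => K * Laplacian.laplacian (θ t) x := by
  rcases eq_or_ne K 0 with rfl | hK
  · simp
  · exact ((continuous_laplacian (h.contDiff_two_temperature hK t
      ⟨ht.1, ht.2.le⟩)).integrable_of_hasCompactSupport (hasCompactSupport_of_norm_gt fun x hx =>
        h.laplacian_eq_zero_of_velocity_eventuallyEq hγ hK ht (hρ x hx)
          (eventuallyEq_zero_of_norm_gt hu hx))).const_mul K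

theorem integral_mul_laplacian_eq_zero (h : IsClassicalSolution R γ μ lam K T ρ u s θ)
    (hγ : 1 < γ) (hdecay : K ≠ 0 → TemperatureGradientDecay T θ) (ht : t ∈ Ioo 0 T)
    (hρ : ∀ x, r < ‖x‖ → ρ t x = 0) (hu : ∀ x, r < ‖x‖ → u t x = 0) :
    ∫ x, K * Laplacian.laplacian (θ t) x = 0 := by
  rw [integral_const_mul]
  refine mul_eq_zero.2 (or_iff_not_imp_left.2 fun hK => ?_)
  exact integral_laplacian_eq_zero (h.contDiff_two_temperature hK t ⟨ht.1, ht.2.le⟩)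
    (hdecay hK t ⟨ht.1, ht.2.le⟩) fun x hx =>
      h.laplacian_eq_zero_of_velocity_eventuallyEq hγ hK ht (hρ x hx)
        (eventuallyEq_zero_of_norm_gt hu hx)

theorem integral_energyDensity_eq (h : IsClassicalSolution R γ μ lam K T ρ u s θ) (hγ : 1 < γ)
    (hdecay : K ≠ 0 → TemperatureGradientDecay T θ)
    (hρ : ∀ t ∈ Icc 0 T, ∀ x, r < ‖x‖ → ρ t x = 0)
    (hu : ∀ t ∈ Ioo 0 T, ∀ x, r < ‖x‖ → u t x = 0) (ht : t ∈ Icc 0 T) :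
    ∫ x, energyDensity R γ ρ u θ t x = ∫ x, energyDensity R γ ρ u θ 0 x := by
  have hE := h.isC1OnSlab_energyDensity hγ
  have hEr : ∀ t ∈ Icc 0 T, ∀ x, r < ‖x‖ → energyDensity R γ ρ u θ t x = 0 := fun t ht x hx =>
    energyDensity_eq_zero_of_density_eq_zero (hρ t ht x hx)
  refine eq_of_hasDerivAt_zero (hE.continuousOn_integral volume hEr) (fun t ht => ?_) ht
  have ht' := Ioo_subset_Icc_self ht
  refine (hE.hasDerivAt_integral volume hEr ht).congr_deriv ?_
  have hflux := h.contDiff_energyFlux hγ ht'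
  have hfluxc : ∀ j, HasCompactSupport (energyFlux R γ μ lam ρ u θ t j) := fun j =>
    hasCompactSupport_of_norm_gt fun x hx => energyFlux_eq_zero_of_velocity_eq_zero (hu t ht x hx) j
  simp only [h.deriv_energyDensity hγ ht]
  rw [integral_sub (h.integrable_mul_laplacian hγ ht (hρ t ht') (hu t ht))
      (integrable_finsetSum _ fun j _ => integrable_pderiv (hflux j) (hfluxc j) j),
    h.integral_mul_laplacian_eq_zero hγ hdecay ht (hρ t ht') (hu t ht),
    integral_sum_pderiv_eq_zero hflux hfluxc, sub_zero]

theorem integrable_virial (h : IsClassicalSolution R γ μ lam K T ρ u s θ) (hγ : 1 < γ)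
    (ht : t ∈ Icc 0 T) (hρ : ∀ x, r < ‖x‖ → ρ t x = 0) :
    Integrable fun x => ρ t x * ‖u t x‖ ^ 2 + n * pressure R ρ θ t x := by
  have hslab : IsC1OnSlab T fun t x => ρ t x * ‖u t x‖ ^ 2 + n * pressure R ρ θ t x :=
    ContDiffOn.add (ContDiffOn.mul h.contDiff_density (h.contDiff_velocity.norm_sq ℝ))
      (contDiffOn_const.mul (h.isC1OnSlab_pressure hγ))
  exact hslab.integrable (r := r) volume ht fun x hx => by
    simp [hρ x hx, pressure_eq_zero_of_density_eq_zero]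

theorem integral_sum_momentumFlux_diag (h : IsClassicalSolution R γ μ lam K T ρ u s θ) (hγ : 1 < γ)
    (ht : t ∈ Icc 0 T) (hρ : ∀ x, r < ‖x‖ → ρ t x = 0) (hu : ∀ x, r < ‖x‖ → u t x = 0) :
    ∫ x, ∑ i, momentumFlux R μ lam ρ u θ t i i x
      = ∫ x, (ρ t x * ‖u t x‖ ^ 2 + n * pressure R ρ θ t x) := by
  have hu' : ContDiff ℝ 1 (u t) := IsC1OnSlab.contDiff h.contDiff_velocity ht
  have huc : ∀ j, HasCompactSupport fun x => u t x j := fun j =>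
    hasCompactSupport_of_norm_gt (r := r) fun x hx => by simp [hu x hx]
  have hdiv : Integrable fun x => (2 * μ + n * lam) * divergence (u t) x :=
    (integrable_finsetSum _ fun j _ =>
      integrable_pderiv (contDiff_coord hu' j) (huc j) j).const_mul _
  have hdiv₀ : ∫ x, divergence (u t) x = 0 := integral_sum_pderiv_eq_zero (contDiff_coord hu') huc
  simp only [sum_momentumFlux_diag]
  rw [integral_sub (h.integrable_virial hγ ht hρ) hdiv, integral_const_mul, hdiv₀, mul_zero,
    sub_zero]

theorem isC1OnSlab_density_mul_inner (h : IsClassicalSolution R γ μ lam K T ρ u s θ) :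
    IsC1OnSlab T fun t x => ρ t x * ⟪x, u t x⟫_ℝ :=
  ContDiffOn.mul h.contDiff_density (contDiffOn_snd.inner ℝ h.contDiff_velocity)

theorem hasDerivAt_radialMomentum (h : IsClassicalSolution R γ μ lam K T ρ u s θ) (hγ : 1 < γ)
    (hρ : ∀ t ∈ Icc 0 T, ∀ x, r < ‖x‖ → ρ t x = 0) (ht : t ∈ Ioo 0 T)
    (hu : ∀ x, r < ‖x‖ → u t x = 0) :
    HasDerivAt (radialMomentum ρ u) (∫ x, (ρ t x * ‖u t x‖ ^ 2 + n * pressure R ρ θ t x)) t := by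
  have ht' := Ioo_subset_Icc_self ht
  have hslab := fun i =>
    IsC1OnSlab.mul h.contDiff_density (IsC1OnSlab.coord h.contDiff_velocity i)
  have hderiv : ∀ x : Space n, deriv (fun τ => ρ τ x * ⟪x, u τ x⟫_ℝ) t
      = -∑ i, x i * ∑ j, pderiv j (momentumFlux R μ lam ρ u θ t i j) x := fun x => by
    have hsum : (fun τ => ρ τ x * ⟪x, u τ x⟫_ℝ) = fun τ => ∑ i, x i * (ρ τ x * u τ x i) := by
      funext τ
      simp only [PiLp.inner_apply, Finset.mul_sum, RCLike.inner_apply, conj_trivial]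
      exact Finset.sum_congr rfl fun i _ => by ring
    rw [hsum, deriv_fun_sum fun i _ => ((hslab i).differentiableAt_time ht x).const_mul (x i)]
    simp only [deriv_const_mul_field, h.deriv_momentum hγ ht, mul_neg, Finset.sum_neg_distrib]
  refine (h.isC1OnSlab_density_mul_inner.hasDerivAt_integral (r := r) volume
    (fun t ht x hx => by simp [hρ t ht x hx]) ht).congr_deriv ?_
  simp only [hderiv]
  rw [integral_neg, integral_sum_coord_mul_sum_pderiv (h.contDiff_momentumFlux hγ ht')
    fun i j => hasCompactSupport_of_norm_gt fun x hx =>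
      momentumFlux_eq_zero_of_norm_gt (hρ t ht') hu hx i j, neg_neg,
    h.integral_sum_momentumFlux_diag hγ ht' (hρ t ht') hu]

end IsClassicalSolution

end ConservationLaws

section Lifespan

variable {n : ℕ} {R γ μ lam K T r t : ℝ} {ρ : ℝ → Space n → ℝ} {u : ℝ → Space n → Space n}
  {s θ : ℝ → Space n → ℝ} {x : Space n}

/-- The total energy of the state `(ρ, u, s)` of a polytropic gas, with the internal energy
`p / (γ - 1)` written in terms of density and entropy. -/
def stateEnergy (R γ : ℝ) (ρ : Space n → ℝ) (u : Space n → Space n) (s : Space n → ℝ) : ℝ :=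
  ∫ x, (1 / 2 * ρ x * ‖u x‖ ^ 2 + Real.exp (s x / specificHeat R γ) * ρ x ^ γ / (γ - 1))

namespace IsClassicalSolution

theorem integral_energyDensity_eq_stateEnergy (h : IsClassicalSolution R γ μ lam K T ρ u s θ)
    (ht : t ∈ Icc 0 T) :
    ∫ x, energyDensity R γ ρ u θ t x = stateEnergy R γ (ρ t) (u t) (s t) := by
  simp only [stateEnergy, energyDensity_eq, h.state t ht]

theorem integrable_energyDensity (h : IsClassicalSolution R γ μ lam K T ρ u s θ) (hγ : 1 < γ)
    (ht : t ∈ Icc 0 T) (hρ : ∀ x, r < ‖x‖ → ρ t x = 0) :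
    Integrable (energyDensity R γ ρ u θ t) :=
  (h.isC1OnSlab_energyDensity hγ).integrable volume ht fun x hx =>
    energyDensity_eq_zero_of_density_eq_zero (hρ x hx)

theorem stateEnergy_pos (h : IsClassicalSolution R γ μ lam K T ρ u s θ) (hγ : 1 < γ)
    (ht : t ∈ Icc 0 T) (hρ : ∀ x, r < ‖x‖ → ρ t x = 0) (hM : 0 < ∫ x, ρ t x) :
    0 < stateEnergy R γ (ρ t) (u t) (s t) := by
  obtain ⟨x, hx⟩ : ∃ x, ρ t x ≠ 0 := by
    by_contra! hzero
    simp [hzero] at hM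
  have hρx : 0 < ρ t x := (h.density_nonneg t ht x).lt_of_ne' hx
  rw [← h.integral_energyDensity_eq_stateEnergy ht]
  refine ((h.isC1OnSlab_energyDensity hγ).contDiff
    ht).continuous.integral_pos_of_hasCompactSupport_nonneg_nonzero (x := x)
    (hasCompactSupport_of_norm_gt fun y hy => energyDensity_eq_zero_of_density_eq_zero (hρ y hy))
    (h.energyDensity_nonneg hγ ht) (ne_of_gt ?_)
  rw [energyDensity_eq, h.state t ht x]
  exact add_pos_of_nonneg_of_pos (by positivity)
    (div_pos (mul_pos (Real.exp_pos _) (Real.rpow_pos_of_pos hρx γ)) (sub_pos.2 hγ))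

theorem norm_density_mul_inner_le (h : IsClassicalSolution R γ μ lam K T ρ u s θ) (hγ : 1 < γ)
    (hr : 0 ≤ r) (ht : t ∈ Icc 0 T) (hx : ‖x‖ ≤ r) :
    ‖ρ t x * ⟪x, u t x⟫_ℝ‖ ≤ r * (ρ t x / 2 + energyDensity R γ ρ u θ t x) := by
  have hρ := h.density_nonneg t ht x
  have hkinetic : ρ t x * ‖u t x‖ ≤ ρ t x / 2 + 1 / 2 * ρ t x * ‖u t x‖ ^ 2 := by
    nlinarith [mul_nonneg hρ (sq_nonneg (‖u t x‖ - 1))]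
  have hinternal : 0 ≤ pressure R ρ θ t x / (γ - 1) :=
    div_nonneg (h.pressure_nonneg ht x) (sub_nonneg.2 hγ.le)
  calc ‖ρ t x * ⟪x, u t x⟫_ℝ‖ = ρ t x * ‖⟪x, u t x⟫_ℝ‖ := by
        rw [norm_mul, Real.norm_of_nonneg hρ]
    _ ≤ ρ t x * (r * ‖u t x‖) := by
        gcongr
        exact (norm_inner_le_norm x (u t x)).trans (by gcongr)
    _ = r * (ρ t x * ‖u t x‖) := by ring
    _ ≤ r * (ρ t x / 2 + energyDensity R γ ρ u θ t x) := by
        gcongr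
        rw [energyDensity_eq]
        linarith

theorem abs_radialMomentum_le (h : IsClassicalSolution R γ μ lam K T ρ u s θ) (hγ : 1 < γ)
    (hr : 0 ≤ r) (ht : t ∈ Icc 0 T) (hρ : ∀ x, r < ‖x‖ → ρ t x = 0) :
    |radialMomentum ρ u t|
      ≤ r * ((∫ x, ρ t x) / 2 + ∫ x, energyDensity R γ ρ u θ t x) := by
  have hmass : Integrable fun x => ρ t x / 2 :=
    (IsC1OnSlab.integrable volume h.contDiff_density ht hρ).div_const 2
  have henergy := h.integrable_energyDensity hγ ht hρ
  rw [← integral_div, ← integral_add hmass henergy, ← integral_const_mul]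
  refine norm_integral_le_of_norm_le (f := fun x => ρ t x * ⟪x, u t x⟫_ℝ)
    ((hmass.add henergy).const_mul r) (Eventually.of_forall fun x => ?_)
  rcases lt_or_ge r ‖x‖ with hx | hx
  · simp [hρ x hx, energyDensity_eq_zero_of_density_eq_zero]
  · exact h.norm_density_mul_inner_le hγ hr ht hx

theorem min_mul_energyDensity_le (h : IsClassicalSolution R γ μ lam K T ρ u s θ) (hγ : 1 < γ)
    (ht : t ∈ Icc 0 T) (x : Space n) :
    min 2 (n * (γ - 1)) * energyDensity R γ ρ u θ t x
      ≤ ρ t x * ‖u t x‖ ^ 2 + n * pressure R ρ θ t x := by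
  have hγ' : 0 < γ - 1 := sub_pos.2 hγ
  have hkinetic : 0 ≤ 1 / 2 * ρ t x * ‖u t x‖ ^ 2 :=
    mul_nonneg (mul_nonneg one_half_pos.le (h.density_nonneg t ht x)) (sq_nonneg _)
  have hinternal : 0 ≤ pressure R ρ θ t x / (γ - 1) := div_nonneg (h.pressure_nonneg ht x) hγ'.le
  calc min 2 (n * (γ - 1)) * energyDensity R γ ρ u θ t x
      ≤ 2 * (1 / 2 * ρ t x * ‖u t x‖ ^ 2)
        + n * (γ - 1) * (pressure R ρ θ t x / (γ - 1)) := by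
        rw [energyDensity_eq, mul_add]
        gcongr
        · exact min_le_left _ _
        · exact min_le_right _ _
    _ = ρ t x * ‖u t x‖ ^ 2 + n * pressure R ρ θ t x := by field_simp

theorem min_mul_integral_energyDensity_le (h : IsClassicalSolution R γ μ lam K T ρ u s θ)
    (hγ : 1 < γ) (ht : t ∈ Icc 0 T) (hρ : ∀ x, r < ‖x‖ → ρ t x = 0) :
    min 2 (n * (γ - 1)) * ∫ x, energyDensity R γ ρ u θ t x
      ≤ ∫ x, (ρ t x * ‖u t x‖ ^ 2 + n * pressure R ρ θ t x) := by
  rw [← integral_const_mul]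
  exact integral_mono ((h.integrable_energyDensity hγ ht hρ).const_mul _)
    (h.integrable_virial hγ ht hρ) (h.min_mul_energyDensity_le hγ ht)

theorem min_mul_stateEnergy_mul_le (h : IsClassicalSolution R γ μ lam K T ρ u s θ) (hγ : 1 < γ)
    (hT : 0 ≤ T) (hdecay : K ≠ 0 → TemperatureGradientDecay T θ) (hr : 0 ≤ r)
    (hρ : ∀ t ∈ Icc 0 T, ∀ x, r < ‖x‖ → ρ t x = 0)
    (hu : ∀ t ∈ Ioo 0 T, ∀ x, r < ‖x‖ → u t x = 0) :
    min 2 (n * (γ - 1)) * stateEnergy R γ (ρ 0) (u 0) (s 0) * T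
      ≤ r * ((∫ x, ρ 0 x) + 2 * stateEnergy R γ (ρ 0) (u 0) (s 0)) := by
  have h0 : (0 : ℝ) ∈ Icc 0 T := left_mem_Icc.2 hT
  have hT' : T ∈ Icc 0 T := right_mem_Icc.2 hT
  have henergy : ∀ t ∈ Icc 0 T, ∫ x, energyDensity R γ ρ u θ t x
      = stateEnergy R γ (ρ 0) (u 0) (s 0) := fun t ht => by
    rw [h.integral_energyDensity_eq hγ hdecay hρ hu ht, h.integral_energyDensity_eq_stateEnergy h0]
  have hderiv : ∀ t ∈ Ioo 0 T, HasDerivAt (radialMomentum ρ u) _ t := fun t ht =>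
    h.hasDerivAt_radialMomentum hγ hρ ht (hu t ht)
  have hgrowth := (convex_Icc 0 T).mul_sub_le_image_sub_of_le_deriv
    (f := radialMomentum ρ u) (C := min 2 (n * (γ - 1)) * stateEnergy R γ (ρ 0) (u 0) (s 0))
    (h.isC1OnSlab_density_mul_inner.continuousOn_integral (r := r) volume
      fun t ht x hx => by simp [hρ t ht x hx])
    (fun t ht => (hderiv t (interior_Icc.subset ht)).differentiableAt.differentiableWithinAt)
    (fun t ht => by
      rw [interior_Icc] at ht
      have ht' := Ioo_subset_Icc_self ht
      rw [(hderiv t ht).deriv, ← henergy t ht']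
      exact h.min_mul_integral_energyDensity_le hγ ht' (hρ t ht'))
    0 h0 T hT' hT
  have hbound : ∀ t ∈ Icc 0 T, |radialMomentum ρ u t|
      ≤ r * ((∫ x, ρ 0 x) / 2 + stateEnergy R γ (ρ 0) (u 0) (s 0)) := fun t ht => by
    have hle := h.abs_radialMomentum_le hγ hr ht (hρ t ht)
    rwa [h.integral_density_eq hρ ht, henergy t ht] at hle
  linarith [(abs_le.1 (hbound 0 h0)).1, (abs_le.1 (hbound T hT')).2]

end IsClassicalSolution

end Lifespan

end CNS

end

theorem mainTheorem6_general (n : ℕ) (hn : 1 ≤ n) (R γ μ lam K : ℝ) (hR : 0 < R) (hγ : 1 < γ)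
    (hμ : 0 < μ) (hlam : 0 < 2 * μ + n * lam) (hK : 0 ≤ K)
    (ρ₀ : CNS.Space n → ℝ) (u₀ : CNS.Space n → CNS.Space n) (s₀ : CNS.Space n → ℝ)
    (hρ₀ : HasCompactSupport ρ₀) (hM : 0 < ∫ x, ρ₀ x) :
    ∃ Tstar : ℝ, 0 < Tstar ∧
      ∀ (T : ℝ) (ρ : ℝ → CNS.Space n → ℝ) (u : ℝ → CNS.Space n → CNS.Space n)
        (s θ : ℝ → CNS.Space n → ℝ) (p : ENNReal),
        0 < T →
        CNS.IsClassicalSolution R γ μ lam K T ρ u s θ →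
        (∃ U : ℝ, ∀ t ∈ Icc 0 T, ∀ x, ‖u t x‖ ≤ U) →
        p ≠ 0 → p ≠ ⊤ → (∀ t ∈ Ioo 0 T, MemLp (u t) p) →
        (K ≠ 0 → CNS.TemperatureGradientDecay T θ) →
        ρ 0 = ρ₀ → u 0 = u₀ → s 0 = s₀ →
        T < Tstar := by
  obtain ⟨r, hr, hsupp⟩ := hρ₀.exists_pos_le_norm
  set E₀ := CNS.stateEnergy R γ ρ₀ u₀ s₀
  set c := min 2 (n * (γ - 1))
  refine ⟨|r * ((∫ x, ρ₀ x) + 2 * E₀) / (c * E₀)| + 1, by positivity, ?_⟩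
  rintro T ρ u s θ p hT h ⟨U, hU⟩ hp₀ hp hup hdecay rfl rfl rfl
  have hrest : ∀ t ∈ Ioo 0 T, ∀ a ≥ 0, (∀ x, a < ‖x‖ → ρ t x = 0) → ∀ x, a < ‖x‖ → u t x = 0 :=
    fun t ht a ha hvac _ => h.velocity_eq_zero_of_norm_gt hR hγ hμ hlam hK hdecay hp₀ hp ht
      (hup t ht) ha hvac
  have hconfined : ∀ t ∈ Icc 0 T, ∀ x, r < ‖x‖ → ρ t x = 0 :=
    CNS.density_eq_zero_of_norm_gt h.contDiff_density h.contDiff_velocity h.mass hU hr.le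
      (fun x hx => hsupp x hx.le) hrest
  have hE₀_pos : 0 < E₀ := h.stateEnergy_pos hγ (left_mem_Icc.2 hT.le)
    (hconfined 0 (left_mem_Icc.2 hT.le)) hM
  have hc_pos : 0 < c := lt_min two_pos (mul_pos (Nat.cast_pos.2 hn) (sub_pos.2 hγ))
  have hlife : c * E₀ * T ≤ r * ((∫ x, ρ 0 x) + 2 * E₀) := h.min_mul_stateEnergy_mul_le hγ hT.le
    hdecay hr.le hconfined fun t ht => hrest t ht r hr.le (hconfined t (Ioo_subset_Icc_self ht))
  calc T ≤ r * ((∫ x, ρ 0 x) + 2 * E₀) / (c * E₀) := by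
        rwa [le_div_iff₀' (mul_pos hc_pos hE₀_pos)]
    _ < |r * ((∫ x, ρ 0 x) + 2 * E₀) / (c * E₀)| + 1 := (le_abs_self _).trans_lt (lt_add_one _)

theorem mainTheorem6 (n m : ℕ) (hn : 1 ≤ n) (hm : n / 2 + 2 < m)
    (R γ μ lam K : ℝ) (hR : 0 < R) (hγ : 1 < γ)
    (hμ : 0 < μ) (hlam : 0 < 2 * μ + n * lam) (hK : 0 ≤ K)
    (ρ₀ : CNS.Space n → ℝ) (u₀ : CNS.Space n → CNS.Space n) (s₀ : CNS.Space n → ℝ)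
    (hρ₀ : HasCompactSupport ρ₀) (hM : 0 < ∫ x, ρ₀ x) :
    ∃ Tstar : ℝ, 0 < Tstar ∧
      ∀ (T : ℝ) (ρ : ℝ → CNS.Space n → ℝ) (u : ℝ → CNS.Space n → CNS.Space n)
        (s θ : ℝ → CNS.Space n → ℝ),
        0 < T →
        CNS.IsClassicalSolution R γ μ lam K T ρ u s θ →
        CNS.IsC1Sobolev m T ρ →
        (∀ i : Fin n, CNS.IsC1Sobolev m T fun t x => u t x i) →
        CNS.IsC1Sobolev m T s →
        (K ≠ 0 → CNS.TemperatureGradientDecay T θ) →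
        ρ 0 = ρ₀ → u 0 = u₀ → s 0 = s₀ →
        T < Tstar := by
  obtain ⟨Tstar, hTstar, hlt⟩ :=
    mainTheorem6_general n hn R γ μ lam K hR hγ hμ hlam hK ρ₀ u₀ s₀ hρ₀ hM
  exact ⟨Tstar, hTstar, fun T ρ u s θ hT h _ hu _ =>
    hlt T ρ u s θ 2 hT h
      (CNS.exists_norm_le_of_isC1Sobolev hu (by omega) fun t ht =>
        (h.contDiff_two_velocity t ht).continuous)
      two_ne_zero ENNReal.ofNat_ne_top
      fun t ht => MemLp.of_eval_piLp fun i => (hu i).memLp (Ioo_subset_Icc_self ht)⟩
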